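/- For $n\ge 0$ let $V_n$ be the $\operatorname{SL}_2(\mathbb{C})$-representation on binary forms of degree $n$, and let $V=\bigoplus_{k=1}^r V_{d_k}$ with $r\ge 1$ and $V^{\operatorname{SL}_2}=\{0\}$. Let $\mathbb{C}[V]^{\operatorname{SL}_2}$ be the algebra of invariant polynomial functions on $V$, with the $\mathbb{N}^r$-grading for which the linear coordinates of $V_{d_k}$ have degree the $k$-th unit vector, and let $$\operatorname{Hilb}_V^r(t_1,\ldots,t_r)=\sum_{p\in\mathbb{N}^r}\dim_{\mathbb{C}}\big(\mathbb{C}[V]^{\operatorname{SL}_2}\big)_p\; t_1^{p_1}\cdots t_r^{p_r}$$ be its Hilbert series. Put $a_{k,i}=2i-d_k$ for $1\le k\le r$, $0\le i\le d_k$, and $\Lambda=\{(k,i): a_{k,i}>0\}$. Let $U\subset\mathbb{C}^r$ be the set of all $t=(t_1,\ldots,t_r)$ with $0<|t_k|<1$ for every $k$ such that no $z\in\mathbb{C}$ satisfies both $z^{a_{k,i}}=t_k$ and $z^{a_{k',i'}}=t_{k'}$ for two different pairs $(k,i),(k',i')\in\Lambda$. Then $U$ is open and its closure contains the unit polydisc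 $\{t:|t_k|<1\text{ for all }k\}$. For every $t\in U$ and every choice of logarithms $\ell_k$ of the $t_k$ (i.e. $e^{\ell_k}=t_k$), with $t_k^{q}:=e^{q\ell_k}$ for $q\in\mathbb{Q}$, the series $\operatorname{Hilb}_V^r(t_1,\ldots,t_r)$ converges absolutely and $$\operatorname{Hilb}_V^r(t_1,\ldots,t_r)=\sum_{(K,I)\in\Lambda}\ \sum_{\zeta^{a_{K,I}}=1}\frac{1-\zeta^2\,t_K^{2/a_{K,I}}}{a_{K,I}\,(1-t_K^2)\,\prod_{d_k\in 2\mathbb{Z}}(1-t_k)\,\prod_{(k,i)\in\Lambda\smallsetminus\{(K,I)\}}\beta_{K,I,k,i,\zeta}^r(t_k,t_K)},$$ where $$\beta_{K,I,k,i,\zeta}^r(t_k,t_K)=\big(1-\zeta^{-a_{k,i}}\,t_k\,t_K^{-a_{k,i}/a_{K,I}}\big)\big(1-\zeta^{a_{k,i}}\,t_k\,t_K^{a_{k,i}/a_{K,I}}\big).$$ -/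

import Mathlib

open scoped MatrixGroups

noncomputable section

namespace SL2Hilb

/-- Linear substitution in binary forms: `f(x₀, x₁)` is sent to `f((x₀, x₁) g)`, the pair
`(x₀, x₁)` being a row vector. -/
def subst (g : SL(2, ℂ)) : MvPolynomial (Fin 2) ℂ →ₐ[ℂ] MvPolynomial (Fin 2) ℂ :=
  MvPolynomial.aeval fun j => ∑ i, MvPolynomial.C ((g : Matrix (Fin 2) (Fin 2) ℂ) i j) *
    MvPolynomial.X i

/-- The space `V_n` of binary forms of degree `n` over `ℂ`; its dimension is `n + 1`. -/
abbrev BinaryForm (n : ℕ) : Type := MvPolynomial.homogeneousSubmodule (Fin 2) ℂ n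

theorem subst_mem (g : SL(2, ℂ)) (n : ℕ) (f : MvPolynomial (Fin 2) ℂ)
    (hf : f ∈ MvPolynomial.homogeneousSubmodule (Fin 2) ℂ n) :
    subst g f ∈ MvPolynomial.homogeneousSubmodule (Fin 2) ℂ n := by
  rw [MvPolynomial.mem_homogeneousSubmodule] at hf ⊢
  have := hf.aeval (n := 1) (fun j => ∑ i, MvPolynomial.C
    ((g : Matrix (Fin 2) (Fin 2) ℂ) i j) * MvPolynomial.X i) (fun j => by
      refine MvPolynomial.IsHomogeneous.sum _ _ _ fun i _ => ?_
      simpa using (MvPolynomial.isHomogeneous_C (Fin 2)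
        ((g : Matrix (Fin 2) (Fin 2) ℂ) i j)).mul (MvPolynomial.isHomogeneous_X ℂ i))
  simpa [subst] using this

theorem subst_one : subst 1 = AlgHom.id ℂ _ := by
  apply MvPolynomial.algHom_ext
  intro j
  simp [subst, Matrix.one_apply]

theorem subst_mul (g h : SL(2, ℂ)) : subst (g * h) = (subst g).comp (subst h) := by
  apply MvPolynomial.algHom_ext
  intro j
  simp [subst, Matrix.mul_apply, Fin.sum_univ_two]
  ring

/-- The representation of `SL₂(ℂ)` on the binary forms of degree `n`. -/
def binaryRep (n : ℕ) : Representation ℂ SL(2, ℂ) (BinaryForm n) where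
  toFun g := (subst g).toLinearMap.restrict (subst_mem g n)
  map_one' := by
    refine LinearMap.ext fun f => Subtype.ext ?_
    change subst 1 (f : MvPolynomial (Fin 2) ℂ) = f
    simp [subst_one]
  map_mul' g h := by
    refine LinearMap.ext fun f => Subtype.ext ?_
    change subst (g * h) (f : MvPolynomial (Fin 2) ℂ) = subst g (subst h f)
    simp [subst_mul]

variable {r : ℕ} (d : Fin r → ℕ)

/-- The underlying space of `V = V_{d_1} ⊕ ⋯ ⊕ V_{d_r}`. -/
abbrev V : Type := ∀ k : Fin r, BinaryForm (d k)

/-- The representation of `SL₂(ℂ)` on `V = V_{d_1} ⊕ ⋯ ⊕ V_{d_r}`. -/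
def rep : Representation ℂ SL(2, ℂ) (V d) where
  toFun g := LinearMap.pi fun k => binaryRep (d k) g ∘ₗ LinearMap.proj k
  map_one' := by
    refine LinearMap.ext fun v => funext fun k => ?_
    simp
  map_mul' g h := by
    refine LinearMap.ext fun v => funext fun k => ?_
    simp

/-- The index set of all pairs `(k, i)` with `0 ≤ i ≤ d_k`. -/
abbrev Theta : Type := Σ k : Fin r, Fin (d k + 1)

/-- The linear coordinates of `V`: the coordinate `(k, i)` of `v` is the coefficient of
`x₀ ^ i * x₁ ^ (d_k - i)` in the form `v k`. -/
def coord (v : V d) (x : Theta d) : ℂ :=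
  (v x.1 : MvPolynomial (Fin 2) ℂ).coeff
    (Finsupp.single 0 (x.2 : ℕ) + Finsupp.single 1 (d x.1 - (x.2 : ℕ)))

/-- The algebra `ℂ[V]^{SL₂}` inside `ℂ[V]`, where `ℂ[V]` is the polynomial ring in the linear
coordinates of `V`. -/
def invariantRing : Subalgebra ℂ (MvPolynomial (Theta d) ℂ) where
  carrier := {f | ∀ (g : SL(2, ℂ)) (v : V d),
    MvPolynomial.eval (coord d (rep d g v)) f = MvPolynomial.eval (coord d v) f}
  mul_mem' hf hg := by
    intro g v
    simp only [map_mul, hf g v, hg g v]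
  add_mem' hf hg := by
    intro g v
    simp only [map_add, hf g v, hg g v]
  algebraMap_mem' c := by
    intro g v
    simp [MvPolynomial.algebraMap_eq]

/-- The component of multidegree `p` of `ℂ[V]^{SL₂}`: the invariants all of whose monomials
have, for every `k`, degree `p_k` in the coordinates of `V_{d_k}`. -/
def gradedPiece (p : Fin r →₀ ℕ) : Submodule ℂ (MvPolynomial (Theta d) ℂ) :=
  Subalgebra.toSubmodule (invariantRing d) ⊓
    MvPolynomial.weightedHomogeneousSubmodule ℂ
      (fun x : Theta d => Finsupp.single x.1 1) p

/-- The `ℕ^r`-graded Hilbert series of `ℂ[V]^{SL₂}`. -/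
def hilbertSeries : MvPowerSeries (Fin r) ℂ :=
  fun p => (Module.finrank ℂ (gradedPiece d p) : ℂ)

/-- The weights `a_{k,i} = 2 i - d_k`. -/
def a (x : Theta d) : ℤ := 2 * ((x.2 : ℕ) : ℤ) - (d x.1 : ℤ)

/-- The set `Λ` of all `(k, i)` with `a_{k,i} > 0`. -/
def Lam : Finset (Theta d) := Finset.univ.filter fun x => 0 < a d x

/-- The factor `β_{K,I,k,i,ζ}(t_k, t_K)`, for `X = (K, I)` and `x = (k, i)`. Fractional powers
are formed with the logarithms `l`, that is, `t_K ^ q = exp (q * l_K)`. -/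
def beta (t l : Fin r → ℂ) (X x : Theta d) (ζ : ℂ) : ℂ :=
  (1 - ζ ^ (-a d x) * t x.1 * Complex.exp (-(a d x : ℂ) / (a d X : ℂ) * l X.1)) *
    (1 - ζ ^ (a d x) * t x.1 * Complex.exp ((a d x : ℂ) / (a d X : ℂ) * l X.1))

/-- The sum over `(K, I) ∈ Λ` and over the `a_{K,I}`-th roots of unity `ζ`. -/
def residueSum (t l : Fin r → ℂ) : ℂ :=
  ∑ X ∈ Lam d, ∑ ζ ∈ Polynomial.nthRootsFinset (a d X).toNat (1 : ℂ),
    (1 - ζ ^ 2 * Complex.exp (2 / (a d X : ℂ) * l X.1)) /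
      ((a d X : ℂ) * (1 - t X.1 ^ 2) *
        (∏ k ∈ Finset.univ.filter (fun k : Fin r => Even (d k)), (1 - t k)) *
        ∏ x ∈ (Lam d).erase X, beta d t l X x ζ)

/-- The points of the punctured unit polydisc for which the solutions `z` of the equations
`z ^ a_{k,i} = t_k`, for different `(k, i) ∈ Λ`, are different. -/
def genericSet : Set (Fin r → ℂ) :=
  {t | (∀ k, t k ≠ 0 ∧ ‖t k‖ < 1) ∧
    ∀ x ∈ Lam d, ∀ y ∈ Lam d, x ≠ y →
      ∀ z : ℂ, z ^ (a d x) = t x.1 → z ^ (a d y) ≠ t y.1}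

end SL2Hilb

end

/-! The Hilbert series is computed by counting weights and then taking residues.

The Lie algebra `sl₂` acts on `ℂ[V]` by the derivations `raise`, `lower` and `cartan`. Since `SL₂`
is generated by its unipotent one-parameter subgroups, the invariants are the polynomials killed by
`raise` and `lower` (`mem_invariantRing_iff`). In a fixed multidegree these are the vectors of
weight 0 killed by `raise`, and `raise` maps weight 0 onto weight 2. Hence the dimension of the
graded piece is the number of monomials of weight 0 minus the number of weight 2
(`finrank_gradedPiece`).

By symmetry of sign conventions this difference is the constant term in `z` of `(1 - z²) ∏ (1 - t_k
z^{a_{k,i}})⁻¹`, expanded in geometric series, that is, an integral over the unit circle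
(`hasSum_hilbertSeries_constant_term`). The poles inside the disc are the solutions of `z^{a_{k,i}}
= t_k` with `(k,i) ∈ Λ`. Genericity of `t` makes them simple, and their residues are the summands of
the formula (`circleIntegral_eq_residue_sum`).

The generic set is open because it is cut out by projections along a compact disc, and dense in the
polydisc because it contains the nonvanishing locus of a nonzero polynomial there. -/

noncomputable section

namespace SL2Hilb

/-! ### Finite-dimensional `sl₂` theory in weights 0 and 2. -/

section LieTriple

variable {M : Type*} [AddCommGroup M] [Module ℂ M] {E F H : Module.End ℂ M}

/-- Moving `F` past each factor `E` costs one `H`; the eigenvalues add up to `∑_{j ≤ n} (c + 2j) =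
(n + 1)(c + n)`. -/
theorem lower_raise_pow (hEF : ∀ v, E (F v) - F (E v) = H v) {c : ℂ} {v : M}
    (hv : ∀ n : ℕ, H ((E ^ n) v) = (c + 2 * n) • (E ^ n) v) (n : ℕ) :
    F ((E ^ (n + 1)) v) = (E ^ (n + 1)) (F v) - ((n + 1) * (c + n) : ℂ) • (E ^ n) v := by
  induction n with
  | zero =>
    have h := hEF v
    have h0 := hv 0
    simp only [pow_zero, Module.End.one_apply] at h0
    rw [h0] at h
    simp only [zero_add, pow_one, pow_zero, Module.End.one_apply]
    rw [sub_eq_iff_eq_add, ← sub_eq_iff_eq_add'] at h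
    rw [← h]
    module
  | succ n ih =>
    have h := hEF ((E ^ (n + 1)) v)
    rw [hv, ih] at h
    rw [pow_succ' E (n + 1), Module.End.mul_apply, Module.End.mul_apply]
    simp only [map_sub, map_smul, ← Module.End.mul_apply, ← pow_succ'] at h ⊢
    push_cast at h ⊢
    rw [sub_eq_iff_eq_add, ← sub_eq_iff_eq_add'] at h
    rw [← h]
    module

/-- With `c = 2` the coefficient `(n + 1)(n + 2)` never vanishes, so `E ^ (n + 1) v = 0` forces `E ^
n v = 0`, and one descends to `v`. -/
theorem eq_zero_of_raise_lower_eq_zero (hEF : ∀ v, E (F v) - F (E v) = H v) {v : M}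
    (hv : ∀ n : ℕ, H ((E ^ n) v) = (2 + 2 * n : ℂ) • (E ^ n) v) (h0 : E (F v) = 0)
    (hN : ∃ N : ℕ, (E ^ N) v = 0) : v = 0 := by
  obtain ⟨N, hN⟩ := hN
  induction N with
  | zero => simpa using hN
  | succ n ih =>
    apply ih
    have h := lower_raise_pow hEF hv n
    rw [hN, pow_succ, Module.End.mul_apply, h0, map_zero, map_zero, zero_sub, eq_comm,
      neg_eq_zero, smul_eq_zero] at h
    refine h.resolve_left ?_
    have : ((n + 1 : ℕ) * (2 + n : ℕ) : ℂ) ≠ 0 := by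
      rw [← Nat.cast_mul, Nat.cast_ne_zero]; positivity
    simpa using this

variable {W : ℤ → Submodule ℂ M}

theorem pow_mem_weight {k : ℤ} (hE : ∀ n, ∀ v ∈ W n, E v ∈ W (n + k)) {n : ℤ} {v : M}
    (hv : v ∈ W n) (N : ℕ) : (E ^ N) v ∈ W (n + N * k) := by
  induction N with
  | zero => simpa using hv
  | succ N ih =>
    rw [pow_succ', Module.End.mul_apply]
    convert hE _ _ ih using 2
    push_cast; ring

theorem eq_zero_of_mem_weight_two (hEF : ∀ v, E (F v) - F (E v) = H v)
    (hE : ∀ n, ∀ v ∈ W n, E v ∈ W (n + 2)) (hH : ∀ n, ∀ v ∈ W n, H v = (n : ℂ) • v)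
    {B : ℕ} (hB : ∀ n : ℤ, B < |n| → W n = ⊥) {v : M} (hv : v ∈ W 2) (h0 : E (F v) = 0) :
    v = 0 := by
  refine eq_zero_of_raise_lower_eq_zero hEF (fun n => ?_) h0 ⟨B, ?_⟩
  · rw [hH _ _ (pow_mem_weight hE hv n)]
    push_cast
    congr 1; ring
  -- `E ^ B v` has weight `2 + 2B > B`, beyond the bound on weights.
  · have := pow_mem_weight hE hv B
    rwa [hB _ (by rw [abs_of_nonneg (by positivity)]; omega), Submodule.mem_bot] at this

/-- A highest weight vector of weight 0 is also lowest. The triple `(F, E, -H)` with weights negated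
satisfies the same relations, and `F u` has weight 2 for it. -/
theorem lower_eq_zero (hEF : ∀ v, E (F v) - F (E v) = H v)
    (hF : ∀ n, ∀ v ∈ W n, F v ∈ W (n - 2))
    (hH : ∀ n, ∀ v ∈ W n, H v = (n : ℂ) • v) {B : ℕ} (hB : ∀ n : ℤ, B < |n| → W n = ⊥)
    {u : M} (hu : u ∈ W 0) (h0 : E u = 0) : F u = 0 := by
  refine eq_zero_of_mem_weight_two (E := F) (F := E) (H := -H) (W := fun n => W (-n)) (B := B)
    (fun v => ?_) (fun n v hv => ?_) (fun n v hv => ?_) (fun n hn => ?_) ?_ ?_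
  · rw [LinearMap.neg_apply, ← hEF, neg_sub]
  · convert hF _ _ hv using 2; ring
  · rw [LinearMap.neg_apply, hH _ _ hv]; push_cast; rw [neg_smul, neg_neg]
  · exact hB _ (by rwa [abs_neg])
  · simpa using hF _ _ hu
  · have h := hEF u
    rw [h0, map_zero, sub_zero, hH _ _ hu, Int.cast_zero, zero_smul] at h
    rw [h, map_zero]

/-- `E ∘ F` is injective on the finite-dimensional `W 2`, hence bijective, so `E : W 0 → W 2` is
onto; rank-nullity gives the count. -/
theorem finrank_highest_weight_zero (hEF : ∀ v, E (F v) - F (E v) = H v)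
    (hE : ∀ n, ∀ v ∈ W n, E v ∈ W (n + 2)) (hF : ∀ n, ∀ v ∈ W n, F v ∈ W (n - 2))
    (hH : ∀ n, ∀ v ∈ W n, H v = (n : ℂ) • v) {B : ℕ} (hB : ∀ n : ℤ, B < |n| → W n = ⊥)
    [FiniteDimensional ℂ (W 0)] [FiniteDimensional ℂ (W 2)] :
    Module.finrank ℂ (W 2) + Module.finrank ℂ ↥(W 0 ⊓ LinearMap.ker E) =
      Module.finrank ℂ (W 0) := by
  let e : W 0 →ₗ[ℂ] W 2 := E.restrict fun v hv => by simpa using hE 0 v hv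
  let f : W 2 →ₗ[ℂ] W 0 := F.restrict fun v hv => by simpa using hF 2 v hv
  have hinj : Function.Injective (e ∘ₗ f) := by
    rw [← LinearMap.ker_eq_bot, LinearMap.ker_eq_bot']
    intro v hv
    exact Subtype.ext (eq_zero_of_mem_weight_two hEF hE hH hB v.2 (congrArg Subtype.val hv))
  have hsurj : Function.Surjective e :=
    Function.Surjective.of_comp (g := f) (LinearMap.injective_iff_surjective.1 hinj)
  have hker : Module.finrank ℂ (LinearMap.ker e) =
      Module.finrank ℂ ↥(W 0 ⊓ LinearMap.ker E) := by
    have : (LinearMap.ker e).map (W 0).subtype = W 0 ⊓ LinearMap.ker E := by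
      ext v
      simp only [Submodule.mem_map, LinearMap.mem_ker, Submodule.mem_inf, Submodule.subtype_apply]
      constructor
      · rintro ⟨u, hu, rfl⟩
        exact ⟨u.2, congrArg Subtype.val hu⟩
      · rintro ⟨h1, h2⟩
        exact ⟨⟨v, h1⟩, Subtype.ext h2, rfl⟩
    rw [← this]
    exact (Submodule.equivMapOfInjective _ (W 0).injective_subtype _).finrank_eq
  rw [← hker, ← e.finrank_range_add_finrank_ker, LinearMap.range_eq_top.2 hsurj, finrank_top]

end LieTriple

/-! ### Derivations of polynomial rings: grading, Euler fields and flows. -/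

section Derivations

variable {σ M : Type*}

theorem IsWeightedHomogeneous.derivation [AddCommMonoid M] {w : σ → M} {δ m : M}
    (D : Derivation ℂ (MvPolynomial σ ℂ) (MvPolynomial σ ℂ))
    (hD : ∀ x, (D (MvPolynomial.X x)).IsWeightedHomogeneous w (w x + δ))
    {φ : MvPolynomial σ ℂ} (hφ : φ.IsWeightedHomogeneous w m) :
    (D φ).IsWeightedHomogeneous w (m + δ) := by
  have hD' : D = MvPolynomial.mkDerivation ℂ fun x => D (MvPolynomial.X x) :=
    MvPolynomial.derivation_ext fun x => by rw [MvPolynomial.mkDerivation_X]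
  induction hφ using MvPolynomial.IsWeightedHomogeneous.induction_on with
  | zero => rw [map_zero]; exact MvPolynomial.isWeightedHomogeneous_zero _ _ _
  | add p q _ _ hp hq => rw [map_add]; exact hp.add hq
  | monomial s c hs =>
    rw [hD', MvPolynomial.mkDerivation_monomial, MvPolynomial.smul_eq_C_mul]
    refine MvPolynomial.IsWeightedHomogeneous.C_mul
      (MvPolynomial.IsWeightedHomogeneous.sum _ _ _ fun x hx => ?_) _
    simp only [smul_eq_mul]
    have hx' : Finsupp.single x 1 ≤ s := by
      rw [Finsupp.single_le_iff]; exact Nat.one_le_iff_ne_zero.2 (Finsupp.mem_support_iff.1 hx)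
    convert (MvPolynomial.isWeightedHomogeneous_monomial w (s - Finsupp.single x 1) _ rfl).mul
      (hD x) using 1
    rw [← hs, ← add_assoc]
    conv_lhs => rw [← tsub_add_cancel_of_le hx', map_add, Finsupp.weight_single, one_smul]

theorem coeff_weightDerivation (c : σ → ℂ) (φ : MvPolynomial σ ℂ) (m : σ →₀ ℕ) :
    (MvPolynomial.mkDerivation ℂ (fun x => c x • (MvPolynomial.X x : MvPolynomial σ ℂ)) φ).coeff m
      = Finsupp.weight c m * φ.coeff m := by
  classical
  induction φ using MvPolynomial.induction_on' with
  | add p q hp hq => simp [hp, hq, mul_add]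
  | monomial s b =>
    have h : MvPolynomial.mkDerivation ℂ (fun x => c x • (MvPolynomial.X x : MvPolynomial σ ℂ))
        (MvPolynomial.monomial s b) = Finsupp.weight c s • MvPolynomial.monomial s b := by
      rw [MvPolynomial.mkDerivation_monomial, Finsupp.weight_apply, Finsupp.sum, Finsupp.sum,
        Finset.smul_sum, Finset.sum_smul]
      refine Finset.sum_congr rfl fun x hx => ?_
      have hx' : Finsupp.single x 1 ≤ s := by
        rw [Finsupp.single_le_iff]; exact Nat.one_le_iff_ne_zero.2 (Finsupp.mem_support_iff.1 hx)
      rw [smul_eq_mul, mul_smul_comm, MvPolynomial.X, MvPolynomial.monomial_mul,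
        tsub_add_cancel_of_le hx', MvPolynomial.smul_monomial, MvPolynomial.smul_monomial,
        MvPolynomial.smul_monomial]
      congr 1
      simp only [smul_eq_mul, nsmul_eq_mul]
      ring
    rw [h, MvPolynomial.coeff_smul, smul_eq_mul, MvPolynomial.coeff_monomial]
    split_ifs with hs
    · rw [hs]
    · simp

/-- Chain rule along an integral curve of the vector field `D`: both sides obey the Leibniz rule in
`f`, so the variables suffice. -/
theorem hasDerivAt_eval_curve {D : Derivation ℂ (MvPolynomial σ ℂ) (MvPolynomial σ ℂ)}
    {c : ℂ → σ → ℂ} {s : ℂ}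
    (hc : ∀ x, HasDerivAt (fun s => c s x) (MvPolynomial.eval (c s) (D (MvPolynomial.X x))) s)
    (f : MvPolynomial σ ℂ) :
    HasDerivAt (fun s => MvPolynomial.eval (c s) f) (MvPolynomial.eval (c s) (D f)) s := by
  induction f using MvPolynomial.induction_on with
  | C b => simpa using hasDerivAt_const s b
  | add p q hp hq => simpa only [map_add] using hp.fun_add hq
  | mul_X p x hp =>
    simp only [map_mul, MvPolynomial.eval_X, Derivation.leibniz, map_add, smul_eq_mul]
    exact (hp.fun_mul (hc x)).congr_deriv (by ring)

/-- A family of algebra maps that solves `S' = D ∘ S` on the variables solves it everywhere;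
coefficients keep the derivative complex-valued. -/
theorem hasDerivAt_coeff_algHom {D : Derivation ℂ (MvPolynomial σ ℂ) (MvPolynomial σ ℂ)}
    {S : ℂ → MvPolynomial σ ℂ →ₐ[ℂ] MvPolynomial σ ℂ} {s : ℂ}
    (hS : ∀ x m, HasDerivAt (fun s => (S s (MvPolynomial.X x)).coeff m)
      ((D (S s (MvPolynomial.X x))).coeff m) s)
    (f : MvPolynomial σ ℂ) (m : σ →₀ ℕ) :
    HasDerivAt (fun s => (S s f).coeff m) ((D (S s f)).coeff m) s := by
  classical
  induction f using MvPolynomial.induction_on generalizing m with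
  | C b =>
    have h (s : ℂ) : S s (MvPolynomial.C b) = MvPolynomial.C b := (S s).commutes b
    simpa only [h, MvPolynomial.derivation_C, MvPolynomial.coeff_zero] using
      hasDerivAt_const s ((MvPolynomial.C b : MvPolynomial σ ℂ).coeff m)
  | add p q hp hq => simpa only [map_add, MvPolynomial.coeff_add] using (hp m).fun_add (hq m)
  | mul_X p x hp =>
    rw [map_mul, Derivation.leibniz, smul_eq_mul, smul_eq_mul, add_comm,
      mul_comm (S s (MvPolynomial.X x))]
    simp only [map_mul, MvPolynomial.coeff_mul, MvPolynomial.coeff_add]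
    rw [← Finset.sum_add_distrib]
    exact HasDerivAt.fun_sum fun n _ => (hp n.1).fun_mul (hS x n.2)

end Derivations

/-! ### The `sl₂`-action on `ℂ[V]` by derivations. -/

variable {r : ℕ} (d : Fin r → ℕ)

/-- The coordinate function `(k, n)`, extended by zero to all natural numbers `n`. -/
def coordPoly (k : Fin r) (n : ℕ) : MvPolynomial (Theta d) ℂ :=
  if h : n < d k + 1 then MvPolynomial.X ⟨k, ⟨n, h⟩⟩ else 0

/-- The derivation of `ℂ[V]` induced by the vector field `x₀ ∂/∂x₁`. -/
def raise : Derivation ℂ (MvPolynomial (Theta d) ℂ) (MvPolynomial (Theta d) ℂ) :=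
  MvPolynomial.mkDerivation ℂ fun x =>
    if (x.2 : ℕ) = 0 then 0 else ((d x.1 : ℂ) - (x.2 : ℕ) + 1) • coordPoly d x.1 ((x.2 : ℕ) - 1)

/-- The derivation of `ℂ[V]` induced by the vector field `x₁ ∂/∂x₀`. -/
def lower : Derivation ℂ (MvPolynomial (Theta d) ℂ) (MvPolynomial (Theta d) ℂ) :=
  MvPolynomial.mkDerivation ℂ fun x => (((x.2 : ℕ) : ℂ) + 1) • coordPoly d x.1 ((x.2 : ℕ) + 1)

/-- The derivation of `ℂ[V]` multiplying a monomial by its weight. -/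
def cartan : Derivation ℂ (MvPolynomial (Theta d) ℂ) (MvPolynomial (Theta d) ℂ) :=
  MvPolynomial.mkDerivation ℂ fun x => (-a d x : ℂ) • MvPolynomial.X x

variable {d}

theorem coordPoly_of_le {k : Fin r} {n : ℕ} (h : n ≤ d k) :
    coordPoly d k n = MvPolynomial.X ⟨k, ⟨n, Nat.lt_succ_of_le h⟩⟩ :=
  dif_pos (Nat.lt_succ_of_le h)

theorem coordPoly_of_lt {k : Fin r} {n : ℕ} (h : d k < n) : coordPoly d k n = 0 :=
  dif_neg (by omega)

theorem raise_coordPoly_zero (k : Fin r) : raise d (coordPoly d k 0) = 0 := by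
  rw [coordPoly_of_le (Nat.zero_le _), raise, MvPolynomial.mkDerivation_X, if_pos rfl]

theorem raise_coordPoly_succ {k : Fin r} {n : ℕ} (h : n ≤ d k) :
    raise d (coordPoly d k (n + 1)) = ((d k : ℂ) - n) • coordPoly d k n := by
  rcases h.eq_or_lt with h | h
  -- At the top index both sides vanish, so the bracket computation needs no separate case there.
  · rw [coordPoly_of_lt (by omega), map_zero, h, sub_self, zero_smul]
  · rw [coordPoly_of_le h, raise, MvPolynomial.mkDerivation_X, if_neg (by simp)]
    push_cast
    congr 1
    ring

theorem lower_coordPoly {k : Fin r} {n : ℕ} (h : n ≤ d k) :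
    lower d (coordPoly d k n) = ((n : ℂ) + 1) • coordPoly d k (n + 1) := by
  rw [coordPoly_of_le h, lower, MvPolynomial.mkDerivation_X]

/-- On the coordinate `(k, i)` this is `(i + 1)(d_k - i) - i(d_k - i + 1) = d_k - 2i`. -/
theorem raise_lower_sub (f : MvPolynomial (Theta d) ℂ) :
    raise d (lower d f) - lower d (raise d f) = cartan d f := by
  rw [← Derivation.commutator_apply]
  congr 1
  refine MvPolynomial.derivation_ext fun x => ?_
  obtain ⟨k, i, hi⟩ := x
  rw [Derivation.commutator_apply, cartan, MvPolynomial.mkDerivation_X]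
  have hi' : i ≤ d k := Nat.lt_succ_iff.1 hi
  rw [← coordPoly_of_le hi', lower_coordPoly hi', Derivation.map_smul, raise_coordPoly_succ hi',
    smul_smul]
  cases i with
  | zero =>
    rw [raise_coordPoly_zero, map_zero, sub_zero]
    simp [a]
  | succ n =>
    rw [raise_coordPoly_succ (by omega), Derivation.map_smul, lower_coordPoly (by omega),
      smul_smul, ← sub_smul]
    congr 1
    simp only [a]
    push_cast
    ring

variable (d) in
/-- Multidegree together with the weight. -/
def biweight (x : Theta d) : (Fin r →₀ ℕ) × ℤ := (Finsupp.single x.1 1, -a d x)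

theorem weight_biweight (m : Theta d →₀ ℕ) : Finsupp.weight (biweight d) m =
    (Finsupp.weight (fun x : Theta d => Finsupp.single x.1 1) m,
      Finsupp.weight (fun x => -a d x) m) := by
  simp only [Finsupp.weight_apply, Finsupp.sum, biweight]
  ext1 <;> simp [Prod.fst_sum, Prod.snd_sum]

theorem isWeightedHomogeneous_coordPoly {k : Fin r} {n : ℕ} {b : (Fin r →₀ ℕ) × ℤ}
    (h : n ≤ d k → b = (Finsupp.single k 1, (d k : ℤ) - 2 * n)) :
    (coordPoly d k n).IsWeightedHomogeneous (biweight d) b := by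
  rcases le_or_gt n (d k) with hn | hn
  · rw [coordPoly_of_le hn, h hn]
    convert MvPolynomial.isWeightedHomogeneous_X ℂ (biweight d) _ using 1
    simp [biweight, a]
  · rw [coordPoly_of_lt hn]
    exact MvPolynomial.isWeightedHomogeneous_zero _ _ _

theorem raise_isWeightedHomogeneous {f : MvPolynomial (Theta d) ℂ} {p : Fin r →₀ ℕ} {n : ℤ}
    (hf : f.IsWeightedHomogeneous (biweight d) (p, n)) :
    (raise d f).IsWeightedHomogeneous (biweight d) (p, n + 2) := by
  have := IsWeightedHomogeneous.derivation (δ := (0, 2)) (raise d) (fun x => ?_) hf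
  · simpa using this
  · obtain ⟨k, i, hi⟩ := x
    rw [raise, MvPolynomial.mkDerivation_X]
    split_ifs with h
    · exact MvPolynomial.isWeightedHomogeneous_zero _ _ _
    · rw [MvPolynomial.smul_eq_C_mul]
      refine MvPolynomial.IsWeightedHomogeneous.C_mul (isWeightedHomogeneous_coordPoly ?_) _
      intro _
      simp only [biweight, a, Prod.mk_add_mk, add_zero] at h ⊢
      congr 1
      omega

theorem lower_isWeightedHomogeneous {f : MvPolynomial (Theta d) ℂ} {p : Fin r →₀ ℕ} {n : ℤ}
    (hf : f.IsWeightedHomogeneous (biweight d) (p, n)) :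
    (lower d f).IsWeightedHomogeneous (biweight d) (p, n - 2) := by
  have := IsWeightedHomogeneous.derivation (δ := (0, -2)) (lower d) (fun x => ?_) hf
  · simpa [sub_eq_add_neg] using this
  · obtain ⟨k, i, hi⟩ := x
    rw [lower, MvPolynomial.mkDerivation_X, MvPolynomial.smul_eq_C_mul]
    refine MvPolynomial.IsWeightedHomogeneous.C_mul (isWeightedHomogeneous_coordPoly ?_) _
    intro _
    simp only [biweight, a, Prod.mk_add_mk, add_zero]
    congr 1
    push_cast
    ring

theorem coeff_cartan (f : MvPolynomial (Theta d) ℂ) (m : Theta d →₀ ℕ) :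
    (cartan d f).coeff m = (Finsupp.weight (fun x => -a d x) m : ℤ) * f.coeff m := by
  rw [cartan, coeff_weightDerivation]
  congr 1
  simp [Finsupp.weight_apply, Finsupp.sum]

theorem cartan_of_isWeightedHomogeneous {f : MvPolynomial (Theta d) ℂ} {p : Fin r →₀ ℕ} {n : ℤ}
    (hf : f.IsWeightedHomogeneous (biweight d) (p, n)) : cartan d f = (n : ℂ) • f := by
  ext m
  rw [coeff_cartan, MvPolynomial.coeff_smul, smul_eq_mul]
  by_cases h : f.coeff m = 0
  · rw [h, mul_zero, mul_zero]
  · have := hf h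
    rw [weight_biweight, Prod.mk.injEq] at this
    rw [this.2]

/-! ### Group invariants as common kernel of `raise` and `lower`. -/

/-- The upper unipotent one-parameter subgroup. -/
def upper (s : ℂ) : SL(2, ℂ) := ⟨!![1, s; 0, 1], by simp⟩

/-- The lower unipotent one-parameter subgroup. -/
def lowerUnip (s : ℂ) : SL(2, ℂ) := ⟨!![1, 0; s, 1], by simp⟩

theorem coe_upper (s : ℂ) : (upper s : Matrix (Fin 2) (Fin 2) ℂ) = !![1, s; 0, 1] := rfl

theorem coe_lowerUnip (s : ℂ) : (lowerUnip s : Matrix (Fin 2) (Fin 2) ℂ) = !![1, 0; s, 1] := rfl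

theorem mem_of_upper_lower (S : Submonoid SL(2, ℂ)) (hu : ∀ s, upper s ∈ S)
    (hl : ∀ s, lowerUnip s ∈ S) (g : SL(2, ℂ)) : g ∈ S := by
  have key (g : SL(2, ℂ)) (hg : g 1 0 ≠ 0) : g ∈ S := by
    have h : g = upper ((g 0 0 - 1) / g 1 0) * lowerUnip (g 1 0) *
        upper ((g 1 1 - 1) / g 1 0) := by
      have hdet := g.det_coe
      rw [Matrix.det_fin_two] at hdet
      ext i j
      fin_cases i <;> fin_cases j <;>
        simp [coe_upper, coe_lowerUnip, Matrix.mul_apply, Fin.sum_univ_two] <;> field_simp <;>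
        first | ring1 | linear_combination -hdet
    rw [h]
    exact S.mul_mem (S.mul_mem (hu _) (hl _)) (hu _)
  by_cases hg : g 1 0 = 0
  -- The lower left entry of `lowerUnip 1 * g` is `g 0 0`, nonzero since the determinant is 1; this
  -- reduces to the factorization above.
  · have h : g = lowerUnip (-1) * (lowerUnip 1 * g) := by
      ext i j
      fin_cases i <;> fin_cases j <;>
        simp [coe_lowerUnip, Matrix.mul_apply, Matrix.vecMul, dotProduct, Fin.sum_univ_two]
    rw [h]
    refine S.mul_mem (hl _) (key _ ?_)
    have hdet := g.det_coe
    rw [Matrix.det_fin_two, hg, mul_zero, sub_zero] at hdet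
    have : (lowerUnip 1 * g) 1 0 = g 0 0 := by
      simp [coe_lowerUnip, Matrix.mul_apply, Fin.sum_univ_two, hg]
    rw [this]
    rintro h0
    rw [h0, zero_mul] at hdet
    exact zero_ne_one hdet
  · exact key g hg

theorem upper_zero : upper 0 = 1 := by
  ext i j; fin_cases i <;> fin_cases j <;> simp [upper]

theorem lowerUnip_zero : lowerUnip 0 = 1 := by
  ext i j; fin_cases i <;> fin_cases j <;> simp [lowerUnip]

theorem hasDerivAt_coeff_subst_upper (f : MvPolynomial (Fin 2) ℂ) (m : Fin 2 →₀ ℕ) (s : ℂ) :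
    HasDerivAt (fun s => (subst (upper s) f).coeff m)
      ((MvPolynomial.X 0 * MvPolynomial.pderiv 1 (subst (upper s) f)).coeff m) s := by
  refine hasDerivAt_coeff_algHom (D := (MvPolynomial.X 0 : MvPolynomial (Fin 2) ℂ) •
    MvPolynomial.pderiv 1) (S := fun s => subst (upper s)) (fun x m => ?_) f m
  fin_cases x
  · simpa [subst, upper, Fin.sum_univ_two, MvPolynomial.pderiv_X] using
      hasDerivAt_const s ((MvPolynomial.X 0 : MvPolynomial (Fin 2) ℂ).coeff m)
  · simpa [subst, upper, Fin.sum_univ_two, MvPolynomial.pderiv_X, Pi.single_apply,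
      MvPolynomial.coeff_C_mul] using
        (hasDerivAt_mul_const ((MvPolynomial.X 0 : MvPolynomial (Fin 2) ℂ).coeff m)).add_const
          ((MvPolynomial.X 1 : MvPolynomial (Fin 2) ℂ).coeff m)

theorem hasDerivAt_coeff_subst_lowerUnip (f : MvPolynomial (Fin 2) ℂ) (m : Fin 2 →₀ ℕ) (s : ℂ) :
    HasDerivAt (fun s => (subst (lowerUnip s) f).coeff m)
      ((MvPolynomial.X 1 * MvPolynomial.pderiv 0 (subst (lowerUnip s) f)).coeff m) s := by
  refine hasDerivAt_coeff_algHom (D := (MvPolynomial.X 1 : MvPolynomial (Fin 2) ℂ) •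
    MvPolynomial.pderiv 0) (S := fun s => subst (lowerUnip s)) (fun x m => ?_) f m
  fin_cases x
  · simpa [subst, lowerUnip, Fin.sum_univ_two, MvPolynomial.pderiv_X, Pi.single_apply,
      MvPolynomial.coeff_C_mul] using
        (hasDerivAt_mul_const ((MvPolynomial.X 1 : MvPolynomial (Fin 2) ℂ).coeff m)).const_add
          ((MvPolynomial.X 0 : MvPolynomial (Fin 2) ℂ).coeff m)
  · simpa [subst, lowerUnip, Fin.sum_univ_two, MvPolynomial.pderiv_X] using
      hasDerivAt_const s ((MvPolynomial.X 1 : MvPolynomial (Fin 2) ℂ).coeff m)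

theorem eval_coord_coordPoly (v : V d) {k : Fin r} {n : ℕ} (h : n ≤ d k) :
    MvPolynomial.eval (coord d v) (coordPoly d k n) =
      (v k : MvPolynomial (Fin 2) ℂ).coeff (Finsupp.single 0 n + Finsupp.single 1 (d k - n)) := by
  rw [coordPoly_of_le h, MvPolynomial.eval_X]
  rfl

/-- Identifies the derivation on coordinates with the vector field on forms that generates the flow
of `upper`. -/
theorem eval_raise_X (v : V d) (x : Theta d) :
    MvPolynomial.eval (coord d v) (raise d (MvPolynomial.X x)) =
      (MvPolynomial.X 0 * MvPolynomial.pderiv 1 (v x.1 : MvPolynomial (Fin 2) ℂ)).coeff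
        (Finsupp.single 0 (x.2 : ℕ) + Finsupp.single 1 (d x.1 - (x.2 : ℕ))) := by
  obtain ⟨k, i, hi⟩ := x
  have hi' : i ≤ d k := Nat.lt_succ_iff.1 hi
  rw [← coordPoly_of_le hi', MvPolynomial.coeff_X_mul']
  cases i with
  | zero => rw [raise_coordPoly_zero, if_neg (by simp), map_zero]
  | succ n =>
    rw [raise_coordPoly_succ (by omega), if_pos (by simp), MvPolynomial.smul_eval,
      eval_coord_coordPoly v (by omega), MvPolynomial.coeff_pderiv, mul_comm]
    have h1 : (Finsupp.single 0 (n + 1) + Finsupp.single 1 (d k - (n + 1)) -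
        Finsupp.single 0 1 : Fin 2 →₀ ℕ) =
          Finsupp.single 0 n + Finsupp.single 1 (d k - (n + 1)) := by
      ext j; fin_cases j <;> simp
    have h2 : (Finsupp.single 0 n + Finsupp.single 1 (d k - (n + 1)) + Finsupp.single 1 1 :
        Fin 2 →₀ ℕ) = Finsupp.single 0 n + Finsupp.single 1 (d k - n) := by
      ext j; fin_cases j
      · simp
      · simp; omega
    simp only [h1, h2]
    congr 1
    simp [Nat.cast_sub hi']
    ring

theorem eval_lower_X (v : V d) (x : Theta d) :
    MvPolynomial.eval (coord d v) (lower d (MvPolynomial.X x)) =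
      (MvPolynomial.X 1 * MvPolynomial.pderiv 0 (v x.1 : MvPolynomial (Fin 2) ℂ)).coeff
        (Finsupp.single 0 (x.2 : ℕ) + Finsupp.single 1 (d x.1 - (x.2 : ℕ))) := by
  obtain ⟨k, i, hi⟩ := x
  have hi' : i ≤ d k := Nat.lt_succ_iff.1 hi
  rw [← coordPoly_of_le hi', MvPolynomial.coeff_X_mul', lower_coordPoly hi']
  rcases hi'.eq_or_lt with h | h
  · rw [coordPoly_of_lt (by omega), smul_zero, map_zero, if_neg]
    simp [h]
  · have h0 : d k - i ≠ 0 := by omega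
    rw [if_pos (by simpa using h0), MvPolynomial.smul_eval,
      eval_coord_coordPoly v (by omega), MvPolynomial.coeff_pderiv, mul_comm]
    have h1 : (Finsupp.single 0 i + Finsupp.single 1 (d k - i) -
        Finsupp.single 1 1 : Fin 2 →₀ ℕ) =
          Finsupp.single 0 i + Finsupp.single 1 (d k - (i + 1)) := by
      ext j; fin_cases j
      · simp
      · simp; omega
    have h2 : (Finsupp.single 0 i + Finsupp.single 1 (d k - (i + 1)) + Finsupp.single 0 1 :
        Fin 2 →₀ ℕ) = Finsupp.single 0 (i + 1) + Finsupp.single 1 (d k - (i + 1)) := by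
      ext j; fin_cases j <;> simp
    simp only [h1, h2]
    simp

theorem hasDerivAt_eval_upper (v : V d) (f : MvPolynomial (Theta d) ℂ) (s : ℂ) :
    HasDerivAt (fun s => MvPolynomial.eval (coord d (rep d (upper s) v)) f)
      (MvPolynomial.eval (coord d (rep d (upper s) v)) (raise d f)) s := by
  refine hasDerivAt_eval_curve (c := fun s => coord d (rep d (upper s) v)) (fun x => ?_) f
  rw [eval_raise_X]
  exact hasDerivAt_coeff_subst_upper _ _ s

theorem hasDerivAt_eval_lowerUnip (v : V d) (f : MvPolynomial (Theta d) ℂ) (s : ℂ) :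
    HasDerivAt (fun s => MvPolynomial.eval (coord d (rep d (lowerUnip s) v)) f)
      (MvPolynomial.eval (coord d (rep d (lowerUnip s) v)) (lower d f)) s := by
  refine hasDerivAt_eval_curve (c := fun s => coord d (rep d (lowerUnip s) v)) (fun x => ?_) f
  rw [eval_lower_X]
  exact hasDerivAt_coeff_subst_lowerUnip _ _ s

theorem coord_surjective : Function.Surjective (coord d) := by
  classical
  intro c
  refine ⟨fun k => ⟨∑ i : Fin (d k + 1), MvPolynomial.monomial
    (Finsupp.single 0 (i : ℕ) + Finsupp.single 1 (d k - (i : ℕ))) (c ⟨k, i⟩), ?_⟩, ?_⟩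
  · refine Submodule.sum_mem _ fun i _ => ?_
    rw [MvPolynomial.mem_homogeneousSubmodule]
    refine MvPolynomial.isHomogeneous_monomial _ ?_
    rw [Finsupp.degree_eq_sum]
    have := i.2
    simp
    omega
  · funext x
    obtain ⟨k, i⟩ := x
    simp only [coord, MvPolynomial.coeff_sum, MvPolynomial.coeff_monomial]
    rw [Finset.sum_eq_single i]
    · simp
    · intro j _ hj
      rw [if_neg]
      intro h
      apply hj
      have := DFunLike.congr_fun h 0
      simpa [Fin.ext_iff] using this
    · simp

/-- Differentiating an invariant at `s = 0` along the unipotent subgroups gives one direction.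
Conversely, `f` is constant along their orbits, and they generate the group. -/
theorem mem_invariantRing_iff {f : MvPolynomial (Theta d) ℂ} :
    f ∈ invariantRing d ↔ raise d f = 0 ∧ lower d f = 0 := by
  constructor
  · intro hf
    have hf' : ∀ g v, MvPolynomial.eval (coord d (rep d g v)) f =
      MvPolynomial.eval (coord d v) f := hf
    constructor <;> refine MvPolynomial.funext fun c => ?_ <;>
      obtain ⟨v, rfl⟩ := coord_surjective c <;> rw [map_zero]
    · have h := hasDerivAt_eval_upper v f 0
      simp only [hf', upper_zero, map_one, Module.End.one_apply] at h
      exact h.unique (hasDerivAt_const _ _)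
    · have h := hasDerivAt_eval_lowerUnip v f 0
      simp only [hf', lowerUnip_zero, map_one, Module.End.one_apply] at h
      exact h.unique (hasDerivAt_const _ _)
  · rintro ⟨hr, hl⟩
    let S : Submonoid SL(2, ℂ) :=
      { carrier := {g | ∀ v : V d, MvPolynomial.eval (coord d (rep d g v)) f =
          MvPolynomial.eval (coord d v) f}
        one_mem' := fun v => by simp
        mul_mem' := fun {g h} hg hh v => by
          rw [map_mul, Module.End.mul_apply, hg, hh] }
    have hu (s : ℂ) : upper s ∈ S := fun v => by
      have := is_const_of_deriv_eq_zero
        (fun s => (hasDerivAt_eval_upper v f s).differentiableAt)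
        (fun s => by rw [(hasDerivAt_eval_upper v f s).deriv, hr, map_zero]) s 0
      simpa [upper_zero] using this
    have hl (s : ℂ) : lowerUnip s ∈ S := fun v => by
      have := is_const_of_deriv_eq_zero
        (fun s => (hasDerivAt_eval_lowerUnip v f s).differentiableAt)
        (fun s => by rw [(hasDerivAt_eval_lowerUnip v f s).deriv, hl, map_zero]) s 0
      simpa [lowerUnip_zero] using this
    exact fun g v => mem_of_upper_lower S hu hl g v

/-! ### Dimension of a graded piece by counting monomials. -/

theorem le_multidegree (m : Theta d →₀ ℕ) (x : Theta d) :
    m x ≤ Finsupp.weight (fun x : Theta d => Finsupp.single x.1 1) m x.1 := by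
  rw [Finsupp.weight_apply, Finsupp.sum_fintype _ _ (by simp), Finsupp.finsetSum_apply]
  refine le_trans ?_ (Finset.single_le_sum (fun _ _ => Nat.zero_le _) (Finset.mem_univ x))
  simp

theorem finite_multidegree (p : Fin r →₀ ℕ) :
    {m : Theta d →₀ ℕ | Finsupp.weight (fun x : Theta d => Finsupp.single x.1 1) m = p}.Finite := by
  refine (Set.finite_Iic (Finsupp.equivFunOnFinite.symm fun x : Theta d => p x.1)).subset ?_
  rintro m rfl
  exact fun x => le_multidegree m x

theorem finite_biweight (b : (Fin r →₀ ℕ) × ℤ) :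
    {m : Theta d →₀ ℕ | Finsupp.weight (biweight d) m = b}.Finite := by
  refine (finite_multidegree b.1).subset ?_
  rintro m rfl
  rw [weight_biweight]
  rfl

theorem finiteDimensional_biweight (b : (Fin r →₀ ℕ) × ℤ) :
    FiniteDimensional ℂ (MvPolynomial.weightedHomogeneousSubmodule ℂ (biweight d) b) := by
  rw [MvPolynomial.weightedHomogeneousSubmodule_eq_finsupp_supported]
  have := (finite_biweight (d := d) b).to_subtype
  exact Module.Finite.of_basis (MvPolynomial.basisRestrictSupport ℂ _)

theorem finrank_biweight (b : (Fin r →₀ ℕ) × ℤ) :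
    Module.finrank ℂ (MvPolynomial.weightedHomogeneousSubmodule ℂ (biweight d) b) =
      {m : Theta d →₀ ℕ | Finsupp.weight (biweight d) m = b}.ncard := by
  rw [MvPolynomial.weightedHomogeneousSubmodule_eq_finsupp_supported]
  exact Module.finrank_eq_nat_card_basis (MvPolynomial.basisRestrictSupport ℂ _)

theorem exists_weight_bound (p : Fin r →₀ ℕ) : ∃ B : ℕ, ∀ n : ℤ, B < |n| →
    MvPolynomial.weightedHomogeneousSubmodule ℂ (biweight d) (p, n) = ⊥ := by
  obtain ⟨B, hB⟩ := ((finite_multidegree (d := d) p).image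
    fun m => (Finsupp.weight (fun x => -a d x) m).natAbs).bddAbove
  refine ⟨B, fun n hn => (Submodule.eq_bot_iff _).2 fun f hf => ?_⟩
  refine MvPolynomial.IsWeightedHomogeneous.eq_zero_of_no_monomials hf fun m hm => ?_
  rw [weight_biweight, Prod.mk.injEq] at hm
  have := hB ⟨m, hm.1, rfl⟩
  simp only [hm.2] at this
  rw [Int.abs_eq_natAbs] at hn
  omega

theorem raise_lower_zero_weight {p : Fin r →₀ ℕ} {f : MvPolynomial (Theta d) ℂ}
    (hf : f.IsWeightedHomogeneous (biweight d) (p, 0)) (h : raise d f = 0) : lower d f = 0 := by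
  obtain ⟨B, hB⟩ := exists_weight_bound (d := d) p
  exact lower_eq_zero (E := (raise d).toLinearMap) (F := (lower d).toLinearMap)
    (H := (cartan d).toLinearMap)
    (W := fun n => MvPolynomial.weightedHomogeneousSubmodule ℂ (biweight d) (p, n))
    raise_lower_sub (fun n v hv => lower_isWeightedHomogeneous hv)
    (fun n v hv => cartan_of_isWeightedHomogeneous hv) hB hf h

/-- Invariants have weight 0 because `cartan` is the commutator of `raise` and `lower`; conversely,
in weight 0 the kernel of `raise` lies in that of `lower`. -/
theorem gradedPiece_eq (p : Fin r →₀ ℕ) : gradedPiece d p =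
    MvPolynomial.weightedHomogeneousSubmodule ℂ (biweight d) (p, 0) ⊓
      LinearMap.ker (raise d).toLinearMap := by
  ext f
  simp only [gradedPiece, Submodule.mem_inf, Subalgebra.mem_toSubmodule, mem_invariantRing_iff,
    LinearMap.mem_ker, MvPolynomial.mem_weightedHomogeneousSubmodule]
  constructor
  · rintro ⟨⟨hr, hl⟩, hf⟩
    refine ⟨fun m hm => ?_, hr⟩
    rw [weight_biweight, hf hm]
    congr 1
    have h := congrArg (MvPolynomial.coeff m) (raise_lower_sub f)
    rw [hr, hl, map_zero, map_zero, sub_zero, MvPolynomial.coeff_zero, coeff_cartan, eq_comm,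
      mul_eq_zero, Int.cast_eq_zero] at h
    exact h.resolve_right hm
  · rintro ⟨hf, hr⟩
    refine ⟨⟨hr, raise_lower_zero_weight hf hr⟩, fun m hm => ?_⟩
    have := hf hm
    rw [weight_biweight, Prod.mk.injEq] at this
    exact this.1

/-- Stated additively to avoid truncated subtraction. -/
theorem finrank_gradedPiece (p : Fin r →₀ ℕ) :
    {m : Theta d →₀ ℕ | Finsupp.weight (biweight d) m = (p, 2)}.ncard + Module.finrank ℂ (gradedPiece d p) =
      {m : Theta d →₀ ℕ | Finsupp.weight (biweight d) m = (p, 0)}.ncard := by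
  obtain ⟨B, hB⟩ := exists_weight_bound (d := d) p
  rw [gradedPiece_eq, ← finrank_biweight, ← finrank_biweight]
  have := finiteDimensional_biweight (d := d) (p, 0)
  have := finiteDimensional_biweight (d := d) (p, 2)
  exact finrank_highest_weight_zero (E := (raise d).toLinearMap) (F := (lower d).toLinearMap)
    (H := (cartan d).toLinearMap)
    (W := fun n => MvPolynomial.weightedHomogeneousSubmodule ℂ (biweight d) (p, n))
    raise_lower_sub (fun n v hv => raise_isWeightedHomogeneous hv)
    (fun n v hv => lower_isWeightedHomogeneous hv)
    (fun n v hv => cartan_of_isWeightedHomogeneous hv) hB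

/-! ### Openness and density of the generic set. -/

theorem a_pos {x : Theta d} (hx : x ∈ Lam d) : 0 < a d x := (Finset.mem_filter.1 hx).2

theorem norm_le_one_of_zpow_eq {z s : ℂ} {n : ℤ} (hn : 0 < n) (h : z ^ n = s) (hs : ‖s‖ < 1) :
    ‖z‖ ≤ 1 := by
  lift n to ℕ using hn.le
  rw [zpow_natCast] at h
  refine le_of_not_gt fun hz => ?_
  have := one_le_pow₀ hz.le (n := n)
  rw [← norm_pow, h] at this
  exact this.not_gt hs

/-- Projection along the compact disc is a closed map. All common roots lie in that disc by
`norm_le_one_of_zpow_eq`. -/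
theorem isClosed_common_root {X : Type*} [TopologicalSpace X] {u v : X → ℂ} (hu : Continuous u)
    (hv : Continuous v) (m n : ℕ) :
    IsClosed {t | ∃ z ∈ Metric.closedBall (0 : ℂ) 1, z ^ m = u t ∧ z ^ n = v t} := by
  have : CompactSpace (Metric.closedBall (0 : ℂ) 1) :=
    isCompact_iff_compactSpace.1 (isCompact_closedBall _ _)
  have h : IsClosed {q : X × Metric.closedBall (0 : ℂ) 1 |
      (q.2 : ℂ) ^ m = u q.1 ∧ (q.2 : ℂ) ^ n = v q.1} :=
    (isClosed_eq (by fun_prop) (by fun_prop)).inter (isClosed_eq (by fun_prop) (by fun_prop))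
  convert isClosedMap_fst_of_compactSpace _ h using 1
  ext t
  constructor
  · rintro ⟨z, hz, h⟩
    exact ⟨(t, ⟨z, hz⟩), h, rfl⟩
  · rintro ⟨⟨_, z⟩, h, rfl⟩
    exact ⟨z, z.2, h⟩

theorem isOpen_genericSet (d : Fin r → ℕ) : IsOpen (genericSet d) := by
  have h : genericSet d = {t | ∀ k, t k ≠ 0 ∧ ‖t k‖ < 1} ∩
      ⋂ x ∈ Lam d, ⋂ y ∈ Lam d, ⋂ _ : x ≠ y, {t | ∃ z ∈ Metric.closedBall (0 : ℂ) 1,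
        z ^ (a d x).toNat = t x.1 ∧ z ^ (a d y).toNat = t y.1}ᶜ := by
    ext t
    simp only [genericSet, Set.mem_ofPred_eq, Set.mem_inter_iff, Set.mem_iInter, Set.mem_compl_iff]
    refine and_congr_right fun ht => forall₅_congr fun x hx y hy hxy => ?_
    push Not
    have hz (x : Theta d) (hx : x ∈ Lam d) (z : ℂ) : z ^ (a d x) = z ^ (a d x).toNat := by
      rw [← zpow_natCast, Int.toNat_of_nonneg (a_pos hx).le]
    simp only [← hz x hx, ← hz y hy]
    refine forall_congr' fun z => ⟨fun h _ => h, fun h h1 => h ?_ h1⟩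
    simpa using norm_le_one_of_zpow_eq (a_pos hx) h1 (ht _).2
  rw [h]
  refine IsOpen.inter ?_ ?_
  · simp only [Set.ofPred_forall]
    refine isOpen_iInter_of_finite fun k => IsOpen.inter ?_ ?_
    · exact isOpen_ne_fun (continuous_apply k) continuous_const
    · exact isOpen_lt (continuous_apply k).norm continuous_const
  · refine isOpen_biInter_finset fun x _ => isOpen_biInter_finset fun y _ =>
      isOpen_iInter_of_finite fun _ => (isClosed_common_root ?_ ?_ _ _).isOpen_compl
    · exact continuous_apply _
    · exact continuous_apply _

/-- On the complex line from `t` to a point `q` where `Q` does not vanish, `Q` has only finitely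
many zeros, so nonzeros accumulate at `t`. -/
theorem dense_eval_ne_zero {σ : Type*} {Q : MvPolynomial σ ℂ} (hQ : Q ≠ 0) :
    Dense {t : σ → ℂ | MvPolynomial.eval t Q ≠ 0} := by
  obtain ⟨q, hq⟩ : ∃ q, MvPolynomial.eval q Q ≠ 0 := by
    by_contra! h
    exact hQ (MvPolynomial.funext fun q => by rw [h, map_zero])
  intro t
  let P : Polynomial ℂ := MvPolynomial.eval₂ Polynomial.C
    (fun k => Polynomial.C (t k) + Polynomial.X * Polynomial.C (q k - t k)) Q
  have hP (s : ℂ) : P.eval s = MvPolynomial.eval (fun k => t k + s * (q k - t k)) Q := by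
    rw [← Polynomial.coe_evalRingHom, MvPolynomial.hom_eval₂, MvPolynomial.eval₂_eq_eval_map]
    have : (Polynomial.evalRingHom s).comp Polynomial.C = RingHom.id ℂ := by ext; simp
    rw [this, MvPolynomial.map_id]
    simp
  have hP0 : P ≠ 0 := by
    intro h
    have := hP 1
    rw [h, Polynomial.eval_zero] at this
    exact hq (by simpa using this.symm)
  have hdense : Dense {s : ℂ | P.eval s ≠ 0} := by
    have : {s : ℂ | P.eval s ≠ 0} = (P.roots.toFinset : Set ℂ)ᶜ := by
      ext s; simp [hP0]
    rw [this]
    exact P.roots.toFinset.finite_toSet.countable.dense_compl ℂ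
  have hc : Continuous fun s : ℂ => fun k => t k + s * (q k - t k) := by fun_prop
  have h0 : (fun k => t k + (0 : ℂ) * (q k - t k)) = t := by simp
  rw [← h0]
  refine closure_mono ?_ (image_closure_subset_closure_image hc
    (Set.mem_image_of_mem _ (hdense 0)))
  rintro _ ⟨s, hs, rfl⟩
  rw [Set.mem_ofPred_eq, ← hP]
  exact hs

/-- A common root `z` forces `t_x ^ a_y = z ^ (a_x a_y) = t_y ^ a_x`, so this polynomial vanishes at
every point excluded by the pair. For equal `k` the exponents differ. -/
theorem X_pow_sub_X_pow_ne_zero {x y : Theta d} (hx : x ∈ Lam d) (hy : y ∈ Lam d)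
    (hxy : x ≠ y) : (MvPolynomial.X x.1 ^ (a d y).toNat - MvPolynomial.X y.1 ^ (a d x).toNat :
      MvPolynomial (Fin r) ℂ) ≠ 0 := by
  intro h
  by_cases hk : x.1 = y.1
  · have h2 := congrArg (MvPolynomial.eval fun _ => (2 : ℂ)) h
    simp only [map_sub, map_pow, MvPolynomial.eval_X, map_zero, sub_eq_zero] at h2
    have h3 : (2 : ℕ) ^ (a d y).toNat = 2 ^ (a d x).toNat := by exact_mod_cast h2
    have h4 := Nat.pow_right_injective le_rfl h3
    have := a_pos hx
    have := a_pos hy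
    obtain ⟨k, i⟩ := x
    obtain ⟨k', j⟩ := y
    obtain rfl : k = k' := hk
    simp only [a] at *
    refine hxy ?_
    congr 1
    exact Fin.ext (by omega)
  · have h2 := congrArg (MvPolynomial.eval (Pi.single y.1 (1 : ℂ))) h
    have := a_pos hy
    have h4 : (a d y).toNat ≠ 0 := by omega
    simp [hk, h4] at h2

theorem subset_closure_genericSet (d : Fin r → ℕ) :
    {t : Fin r → ℂ | ∀ k, ‖t k‖ < 1} ⊆ closure (genericSet d) := by
  classical
  let Q : MvPolynomial (Fin r) ℂ := (∏ k, MvPolynomial.X k) *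
    ∏ q ∈ (Lam d ×ˢ Lam d).filter (fun q => q.1 ≠ q.2),
      (MvPolynomial.X q.1.1 ^ (a d q.2).toNat - MvPolynomial.X q.2.1 ^ (a d q.1).toNat)
  have hQ : Q ≠ 0 := by
    refine mul_ne_zero (Finset.prod_ne_zero_iff.2 fun k _ => MvPolynomial.X_ne_zero k)
      (Finset.prod_ne_zero_iff.2 fun q hq => ?_)
    simp only [Finset.mem_filter, Finset.mem_product] at hq
    exact X_pow_sub_X_pow_ne_zero hq.1.1 hq.1.2 hq.2
  have hopen : IsOpen {t : Fin r → ℂ | ∀ k, ‖t k‖ < 1} := by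
    simp only [Set.ofPred_forall]
    exact isOpen_iInter_of_finite fun k => isOpen_lt (continuous_apply k).norm continuous_const
  refine (Dense.open_subset_closure_inter (dense_eval_ne_zero hQ) hopen).trans (closure_mono ?_)
  rintro t ⟨ht, hQt⟩
  simp only [Q, Set.mem_ofPred_eq, map_mul, map_prod, mul_ne_zero_iff, Finset.prod_ne_zero_iff,
    MvPolynomial.eval_X, map_sub, map_pow, sub_ne_zero] at hQt
  refine ⟨fun k => ⟨hQt.1 k (Finset.mem_univ k), ht k⟩, fun x hx y hy hxy z hzx hzy => ?_⟩
  refine hQt.2 (x, y) (by simp [hx, hy, hxy]) ?_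
  simp only
  have hz (x : Theta d) (hx : x ∈ Lam d) : z ^ (a d x) = z ^ (a d x).toNat := by
    rw [← zpow_natCast, Int.toNat_of_nonneg (a_pos hx).le]
  rw [← hzx, ← hzy, hz x hx, hz y hy, ← pow_mul, ← pow_mul, mul_comm]

/-! ### Products of geometric series. -/

section GeometricProduct

/-- Sum and absolute convergence are proved together, since multiplying in one more series uses
both. -/
theorem hasSum_pi_geometric (σ : Type*) [Fintype σ] (c : σ → ℂ) (hc : ∀ x, ‖c x‖ < 1) :
    HasSum (fun m : σ → ℕ => ∏ x, c x ^ m x) (∏ x, (1 - c x)⁻¹) ∧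
      Summable fun m : σ → ℕ => ‖∏ x, c x ^ m x‖ := by
  revert c
  refine Fintype.induction_empty_option (P := fun σ _ => ∀ c : σ → ℂ, (∀ x, ‖c x‖ < 1) →
    HasSum (fun m : σ → ℕ => ∏ x, c x ^ m x) (∏ x, (1 - c x)⁻¹) ∧
      Summable fun m : σ → ℕ => ‖∏ x, c x ^ m x‖) ?_ ?_ ?_ σ
  · intro α β _ e h c hc
    let _ := Fintype.ofEquiv β e.symm
    obtain ⟨h1, h2⟩ := h (c ∘ e) fun x => hc (e x)
    have key (m : β → ℕ) : ∏ x, (c ∘ e) x ^ (m ∘ e) x = ∏ x, c x ^ m x :=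
      Fintype.prod_equiv e _ _ fun _ => rfl
    rw [← (Equiv.arrowCongr e.symm (Equiv.refl ℕ)).hasSum_iff] at h1
    rw [← (Equiv.arrowCongr e.symm (Equiv.refl ℕ)).summable_iff] at h2
    have hp : ∏ x, (1 - (c ∘ e) x)⁻¹ = ∏ x, (1 - c x)⁻¹ := Fintype.prod_equiv e _ _ fun _ => rfl
    rw [hp] at h1
    constructor
    · convert h1 using 1
      exact funext fun m => (key m).symm
    · convert h2 using 1
      exact funext fun m => congrArg norm (key m).symm
  · intro c _
    constructor
    · simp
    · exact Summable.of_finite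
  · intro α _ h c hc
    obtain ⟨h1, h2⟩ := h (fun x => c (some x)) fun x => hc _
    have h3 := hasSum_geometric_of_norm_lt_one (hc none)
    have h4 : Summable fun n : ℕ => ‖c none ^ n‖ := by
      simpa only [norm_pow] using summable_geometric_of_lt_one (norm_nonneg _) (hc none)
    have h5 := h4.mul_norm h2
    have h6 := h3.mul h1 h5.of_norm
    rw [← (Equiv.piOptionEquivProd (β := fun _ : Option α => ℕ)).hasSum_iff] at h6
    rw [← (Equiv.piOptionEquivProd (β := fun _ : Option α => ℕ)).summable_iff] at h5
    simp only [Fintype.prod_option]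
    exact ⟨h6, h5⟩

variable {σ : Type*} [Fintype σ]

theorem hasSum_finsupp_geometric {c : σ → ℂ} (hc : ∀ x, ‖c x‖ < 1) :
    HasSum (fun m : σ →₀ ℕ => ∏ x, c x ^ m x) (∏ x, (1 - c x)⁻¹) := by
  have h := (hasSum_pi_geometric σ c hc).1
  rw [← (Finsupp.equivFunOnFinite (α := σ) (M := ℕ)).hasSum_iff] at h
  exact h

theorem summable_finsupp_geometric {c : σ → ℂ} (hc : ∀ x, ‖c x‖ < 1) :
    Summable fun m : σ →₀ ℕ => ‖∏ x, c x ^ m x‖ := by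
  have h := (hasSum_pi_geometric σ c hc).2
  rw [← (Finsupp.equivFunOnFinite (α := σ) (M := ℕ)).summable_iff] at h
  exact h

end GeometricProduct

/-! ### Constant terms and residues on the unit circle. -/

section CircleIntegral

open Real Complex

theorem hasSum_circleIntegral {ι : Type*} [Countable ι] {F : ι → ℂ → ℂ} {f : ℂ → ℂ} {u : ι → ℝ}
    (hF : ∀ n, ContinuousOn (F n) (Metric.sphere 0 1))
    (hu : ∀ n, ∀ z ∈ Metric.sphere (0 : ℂ) 1, ‖F n z‖ ≤ u n) (hs : Summable u)
    (hf : ∀ z ∈ Metric.sphere (0 : ℂ) 1, HasSum (fun n => F n z) (f z)) :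
    HasSum (fun n => ∮ z in C(0, 1), F n z) (∮ z in C(0, 1), f z) := by
  have hmem (θ : ℝ) : circleMap 0 1 θ ∈ Metric.sphere (0 : ℂ) 1 :=
    circleMap_mem_sphere _ zero_le_one _
  refine intervalIntegral.hasSum_integral_of_dominated_convergence (fun n _ => u n)
    (fun n => ?_) (fun n => ?_) ?_ ?_ ?_
  · exact ((hF n).circleIntegrable zero_le_one).out.def'.1
  · refine .of_forall fun θ _ => ?_
    rw [norm_smul]
    simpa [deriv_circleMap] using hu n _ (hmem θ)
  · exact .of_forall fun _ _ => hs
  · exact intervalIntegrable_const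
  · exact .of_forall fun θ _ => (hf _ (hmem θ)).const_smul _

theorem circleIntegral_zpow (n : ℤ) :
    (∮ z in C(0, 1), z ^ n) = if n = -1 then 2 * π * I else 0 := by
  split_ifs with h
  · have := circleIntegral.integral_sub_center_inv (0 : ℂ) one_ne_zero
    simpa [h] using this
  · simpa using circleIntegral.integral_sub_zpow_of_ne h 0 0 1

theorem continuousOn_zpow_sphere (n : ℤ) :
    ContinuousOn (fun z : ℂ => z ^ n) (Metric.sphere 0 1) := fun z hz =>
  (continuousAt_zpow₀ z n (Or.inl (ne_zero_of_mem_unit_sphere ⟨z, hz⟩))).continuousWithinAt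

variable {σ : Type*} [Fintype σ]

theorem zpow_sum {z : ℂ} (hz : z ≠ 0) {ι : Type*} (s : Finset ι) (f : ι → ℤ) :
    z ^ ∑ i ∈ s, f i = ∏ i ∈ s, z ^ f i := by
  classical
  induction s using Finset.induction_on with
  | empty => simp
  | insert i s hi ih => rw [Finset.sum_insert hi, Finset.prod_insert hi, zpow_add₀ hz, ih]

theorem prod_mul_zpow_pow (t : σ → ℂ) (b : σ → ℤ) (m : σ →₀ ℕ) {z : ℂ} (hz : z ≠ 0) :
    ∏ x, (t x * z ^ b x) ^ m x = (∏ x, t x ^ m x) * z ^ Finsupp.weight b m := by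
  simp only [mul_pow, Finset.prod_mul_distrib]
  congr 1
  rw [Finsupp.weight_apply, Finsupp.sum_fintype _ _ (by simp)]
  rw [zpow_sum hz]
  refine Finset.prod_congr rfl fun x _ => ?_
  rw [nsmul_eq_mul, mul_comm, zpow_mul, zpow_natCast]

/-- Integrating `(z⁻¹ - z) z ^ w` picks out `w = 0` with sign `+` and `w = -2` with sign `-`. On the
circle the series is dominated by twice the series of norms. -/
theorem hasSum_constant_term {t : σ → ℂ} (ht : ∀ x, ‖t x‖ < 1) (b : σ → ℤ) :
    HasSum (fun m : σ →₀ ℕ => (∏ x, t x ^ m x) *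
        ((if Finsupp.weight b m = 0 then 1 else 0) - if Finsupp.weight b m = -2 then 1 else 0))
      ((2 * π * I)⁻¹ * ∮ z in C(0, 1), (z⁻¹ - z) * ∏ x, (1 - t x * z ^ b x)⁻¹) := by
  have hterm (m : σ →₀ ℕ) : (∏ x, t x ^ m x) *
      ((if Finsupp.weight b m = 0 then 1 else 0) - if Finsupp.weight b m = -2 then 1 else 0) =
      (2 * π * I)⁻¹ * ∮ z in C(0, 1), (∏ x, t x ^ m x) *
        (z ^ (Finsupp.weight b m - 1) - z ^ (Finsupp.weight b m + 1)) := by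
    rw [circleIntegral.integral_const_mul, circleIntegral.integral_sub
      ((continuousOn_zpow_sphere _).circleIntegrable zero_le_one)
      ((continuousOn_zpow_sphere _).circleIntegrable zero_le_one), circleIntegral_zpow,
      circleIntegral_zpow, mul_left_comm]
    congr 1
    have h1 : Finsupp.weight b m - 1 = -1 ↔ Finsupp.weight b m = 0 := by omega
    have h2 : Finsupp.weight b m + 1 = -1 ↔ Finsupp.weight b m = -2 := by omega
    simp only [h1, h2, mul_sub, mul_ite, mul_zero, inv_mul_cancel₀ two_pi_I_ne_zero]
  simp only [hterm]
  refine HasSum.mul_left _ (hasSum_circleIntegral (u := fun m => ‖∏ x, t x ^ m x‖ * 2)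
    (fun m => ?_) (fun m z hz => ?_) ?_ fun z hz => ?_)
  · exact continuousOn_const.mul ((continuousOn_zpow_sphere _).sub (continuousOn_zpow_sphere _))
  · rw [norm_mul]
    refine mul_le_mul_of_nonneg_left ((norm_sub_le _ _).trans ?_) (norm_nonneg _)
    rw [mem_sphere_zero_iff_norm] at hz
    rw [norm_zpow, norm_zpow, hz, one_zpow, one_zpow]
    norm_num
  · exact (summable_finsupp_geometric ht).mul_right 2
  · have hz0 : z ≠ 0 := ne_zero_of_mem_unit_sphere ⟨z, hz⟩
    rw [mem_sphere_zero_iff_norm] at hz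
    have h := hasSum_finsupp_geometric (c := fun x => t x * z ^ b x)
      fun x => by rw [norm_mul, norm_zpow, hz, one_zpow, mul_one]; exact ht x
    have key (m : σ →₀ ℕ) : (∏ x, t x ^ m x) *
        (z ^ (Finsupp.weight b m - 1) - z ^ (Finsupp.weight b m + 1)) =
        (z⁻¹ - z) * ∏ x, (t x * z ^ b x) ^ m x := by
      rw [prod_mul_zpow_pow _ _ _ hz0, zpow_sub_one₀ hz0, zpow_add_one₀ hz0]
      ring
    simp only [key]
    exact h.mul_left _

/-- Lagrange interpolation of the constant 1 at the nodes `ρ i` is the partial fraction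
decomposition of `(∏ (z - ρ i))⁻¹`; Cauchy's formula then treats each term. -/
theorem circleIntegral_prod_inv {ι : Type*} [DecidableEq ι] {S : Finset ι} (hS : S.Nonempty)
    {ρ : ι → ℂ} (hinj : Set.InjOn ρ S) (hρ : ∀ i ∈ S, ‖ρ i‖ < 1) {G : ℂ → ℂ}
    (hG : DifferentiableOn ℂ G (Metric.closedBall 0 1)) :
    (2 * π * I)⁻¹ * (∮ z in C(0, 1), (∏ i ∈ S, (z - ρ i))⁻¹ * G z) =
      ∑ i ∈ S, Lagrange.nodalWeight S ρ i * G (ρ i) := by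
  have hne {z : ℂ} (hz : z ∈ Metric.sphere (0 : ℂ) 1) {i : ι} (hi : i ∈ S) : z ≠ ρ i := by
    rintro rfl
    rw [mem_sphere_zero_iff_norm] at hz
    exact (hρ i hi).ne hz
  have h1 : (∮ z in C(0, 1), (∏ i ∈ S, (z - ρ i))⁻¹ * G z) =
      ∮ z in C(0, 1), ∑ i ∈ S, Lagrange.nodalWeight S ρ i * ((z - ρ i)⁻¹ • G z) := by
    refine circleIntegral.integral_congr zero_le_one fun z hz => ?_
    have h := Lagrange.eval_interpolate_not_at_node (s := S) (v := ρ) (1 : ι → ℂ)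
      (x := z) fun i hi => hne hz hi
    rw [Lagrange.interpolate_one hinj hS, Polynomial.eval_one, Lagrange.eval_nodal] at h
    rw [← eq_inv_of_mul_eq_one_right h.symm, Finset.sum_mul]
    exact Finset.sum_congr rfl fun i _ => by simp [mul_assoc]
  rw [h1, circleIntegral.integral_fun_sum, Finset.mul_sum]
  · refine Finset.sum_congr rfl fun i hi => ?_
    rw [circleIntegral.integral_const_mul, hG.circleIntegral_sub_inv_smul
      (by simpa using hρ i hi), mul_left_comm, smul_eq_mul, inv_mul_cancel_left₀ two_pi_I_ne_zero]
  · intro i hi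
    refine ContinuousOn.circleIntegrable zero_le_one (continuousOn_const.mul
      (ContinuousOn.smul ((continuousOn_id.sub continuousOn_const).inv₀ fun z hz => ?_)
        (hG.continuousOn.mono Metric.sphere_subset_closedBall)))
    exact sub_ne_zero.2 (hne hz hi)

end CircleIntegral

open Real Complex in
theorem circleIntegral_eq_residue_sum {ι : Type*} [DecidableEq ι] {L : Finset ι}
    (hL : L.Nonempty) {n : ι → ℕ} (hn : ∀ X ∈ L, 0 < n X) {s w : ι → ℂ}
    (hw : ∀ X ∈ L, w X ^ n X = s X) (hs0 : ∀ X ∈ L, s X ≠ 0) (hs1 : ∀ X ∈ L, ‖s X‖ < 1)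
    (hdisj : ∀ X ∈ L, ∀ Y ∈ L, X ≠ Y → ∀ z : ℂ, z ^ n X = s X → z ^ n Y ≠ s Y) :
    (2 * π * I)⁻¹ * (∮ z in C(0, 1), (z⁻¹ - z) *
        ∏ X ∈ L, ((1 - s X * (z ^ n X)⁻¹) * (1 - s X * z ^ n X))⁻¹) =
      ∑ X ∈ L, ∑ ζ ∈ Polynomial.nthRootsFinset (n X) (1 : ℂ),
        (1 - (ζ * w X) ^ 2) / (n X * (1 - s X ^ 2) * ∏ Y ∈ L.erase X,
          ((1 - s Y * ((ζ * w X) ^ n Y)⁻¹) * (1 - s Y * (ζ * w X) ^ n Y))) := by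
  classical
  let S : Finset (Σ _ : ι, ℂ) := L.sigma fun X => Polynomial.nthRootsFinset (n X) (1 : ℂ)
  let ρ : (Σ _ : ι, ℂ) → ℂ := fun q => q.2 * w q.1
  -- The holomorphic part of the integrand. The `- 1` is outside the sum and absorbs the factor
  -- `z⁻¹`; the exponent is a true difference because `L` is nonempty, so there is no pole at 0.
  let G : ℂ → ℂ := fun z => (1 - z ^ 2) * z ^ (∑ X ∈ L, n X - 1) * ∏ X ∈ L, (1 - s X * z ^ n X)⁻¹
  have hw0 : ∀ X ∈ L, w X ≠ 0 := fun X hX h => hs0 X hX <| by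
    rw [← hw X hX, h, zero_pow (hn X hX).ne']
  have hroot {X : ι} (hX : X ∈ L) {ζ : ℂ} (hζ : ζ ∈ Polynomial.nthRootsFinset (n X) (1 : ℂ)) :
      (ζ * w X) ^ n X = s X := by
    rw [mul_pow, (Polynomial.mem_nthRootsFinset (hn X hX) _).1 hζ, one_mul, hw X hX]
  have hpos : 0 < ∑ X ∈ L, n X := Finset.sum_pos hn hL
  have hS : S.Nonempty := by
    obtain ⟨X, hX⟩ := hL
    exact ⟨⟨X, 1⟩, Finset.mem_sigma.2 ⟨hX, (Polynomial.mem_nthRootsFinset (hn X hX) _).2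
      (one_pow _)⟩⟩
  have hinj : Set.InjOn ρ S := by
    rintro ⟨X, ζ⟩ h1 ⟨Y, ξ⟩ h2 h
    obtain ⟨hX, hζ⟩ := Finset.mem_sigma.1 h1
    obtain ⟨hY, hξ⟩ := Finset.mem_sigma.1 h2
    by_cases hXY : X = Y
    · subst hXY
      have h' : ζ = ξ := mul_right_cancel₀ (hw0 X hX) h
      rw [h']
    · refine absurd (hroot hY hξ) ?_
      have h' : ζ * w X = ξ * w Y := h
      rw [← h']
      exact hdisj X hX Y hY hXY _ (hroot hX hζ)
  have hρ : ∀ q ∈ S, ‖ρ q‖ < 1 := by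
    rintro ⟨X, ζ⟩ h
    obtain ⟨hX, hζ⟩ := Finset.mem_sigma.1 h
    have h1 := congrArg norm (hroot hX hζ)
    rw [norm_pow] at h1
    by_contra! h2
    exact (hs1 X hX).not_ge (h1 ▸ one_le_pow₀ h2)
  have hnz {z : ℂ} (hz : ‖z‖ ≤ 1) {X : ι} (hX : X ∈ L) : 1 - s X * z ^ n X ≠ 0 := by
    intro h
    have h1 : ‖s X * z ^ n X‖ = 1 := by rw [← sub_eq_zero.1 h, norm_one]
    rw [norm_mul, norm_pow] at h1
    have h2 := mul_le_of_le_one_right (norm_nonneg (s X)) (pow_le_one₀ (norm_nonneg z) hz (n := n X))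
    linarith [hs1 X hX]
  have hG : DifferentiableOn ℂ G (Metric.closedBall 0 1) := by
    refine DifferentiableOn.mul (by fun_prop) (DifferentiableOn.fun_finsetProd fun X hX =>
      DifferentiableOn.inv (by fun_prop) fun z hz => hnz (by simpa using hz) hX)
  have hprod (z : ℂ) : ∏ q ∈ S, (z - ρ q) = ∏ X ∈ L, (z ^ n X - s X) := by
    rw [Finset.prod_sigma]
    refine Finset.prod_congr rfl fun X hX => ?_
    rw [← hw X hX, (Complex.isPrimitiveRoot_exp _ (hn X hX).ne').pow_sub_pow_eq_prod_sub_mul _ _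
      (hn X hX)]
  have hsplit {X : ι} (hX : X ∈ L) :
      Lagrange.nodal S ρ = (Polynomial.X ^ n X - Polynomial.C (s X)) *
        ∏ Y ∈ L.erase X, (Polynomial.X ^ n Y - Polynomial.C (s Y)) := by
    refine Polynomial.funext fun z => ?_
    rw [Finset.mul_prod_erase L (fun Y => Polynomial.X ^ n Y - Polynomial.C (s Y)) hX,
      Lagrange.eval_nodal, hprod, Polynomial.eval_prod]
    simp
  have hint : (∮ z in C(0, 1), (z⁻¹ - z) *
        ∏ X ∈ L, ((1 - s X * (z ^ n X)⁻¹) * (1 - s X * z ^ n X))⁻¹) =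
      ∮ z in C(0, 1), (∏ q ∈ S, (z - ρ q))⁻¹ * G z := by
    refine circleIntegral.integral_congr zero_le_one fun z hz => ?_
    have hz0 : z ≠ 0 := ne_zero_of_mem_unit_sphere ⟨z, hz⟩
    have h1 : ∏ X ∈ L, ((1 - s X * (z ^ n X)⁻¹) * (1 - s X * z ^ n X))⁻¹ =
        z ^ (∑ X ∈ L, n X) * (∏ X ∈ L, (z ^ n X - s X))⁻¹ * ∏ X ∈ L, (1 - s X * z ^ n X)⁻¹ := by
      rw [← Finset.prod_pow_eq_pow_sum, ← Finset.prod_inv_distrib, ← Finset.prod_mul_distrib,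
        ← Finset.prod_mul_distrib]
      refine Finset.prod_congr rfl fun X _ => ?_
      have : z ^ n X ≠ 0 := pow_ne_zero _ hz0
      rw [mul_inv]
      congr 1
      have h : z ^ n X * (1 - s X * (z ^ n X)⁻¹) = z ^ n X - s X := by field_simp
      rw [← h, mul_inv, mul_inv_cancel_left₀ this]
    simp only [G]
    rw [hprod, h1, ← Nat.sub_add_cancel hpos, pow_succ, Nat.add_sub_cancel]
    field_simp
  rw [hint, circleIntegral_prod_inv hS hinj hρ hG, Finset.sum_sigma]
  refine Finset.sum_congr rfl fun X hX => Finset.sum_congr rfl fun ζ hζ => ?_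
  have hmem : (⟨X, ζ⟩ : Σ _ : ι, ℂ) ∈ S := Finset.mem_sigma.2 ⟨hX, hζ⟩
  have hr := hroot hX hζ
  have hnorm := (hρ _ hmem).le
  rw [Lagrange.nodalWeight_eq_eval_derivative_nodal hmem, hsplit hX]
  simp only [ρ] at hnorm ⊢
  set z := ζ * w X with hz
  have hz0 : z ≠ 0 := fun h => hs0 X hX <| by rw [← hr, h, zero_pow (hn X hX).ne']
  -- The nodal weight is the inverse of this derivative; the other term of the product rule vanishes
  -- since `z ^ n X = s X`.
  have hderiv : (Polynomial.derivative ((Polynomial.X ^ n X - Polynomial.C (s X)) *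
      ∏ Y ∈ L.erase X, (Polynomial.X ^ n Y - Polynomial.C (s Y)))).eval z =
        n X * z ^ (n X - 1) * ∏ Y ∈ L.erase X, (z ^ n Y - s Y) := by
    rw [Polynomial.derivative_mul]
    simp [Polynomial.eval_prod, Polynomial.derivative_X_pow, hr]
  have hexp : ∑ Y ∈ L, n Y - 1 = (n X - 1) + ∑ Y ∈ L.erase X, n Y := by
    have := hn X hX
    rw [← Finset.add_sum_erase L n hX]
    omega
  have hden : ∏ Y ∈ L.erase X, ((1 - s Y * (z ^ n Y)⁻¹) * (1 - s Y * z ^ n Y)) =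
      (z ^ (∑ Y ∈ L.erase X, n Y))⁻¹ * (∏ Y ∈ L.erase X, (z ^ n Y - s Y)) *
        ∏ Y ∈ L.erase X, (1 - s Y * z ^ n Y) := by
    rw [← Finset.prod_pow_eq_pow_sum, ← Finset.prod_inv_distrib, ← Finset.prod_mul_distrib,
      ← Finset.prod_mul_distrib]
    refine Finset.prod_congr rfl fun Y _ => ?_
    have : z ^ n Y ≠ 0 := pow_ne_zero _ hz0
    field_simp
  simp only [G]
  rw [hderiv, hden, hexp, pow_add, ← Finset.mul_prod_erase L _ hX, Finset.prod_inv_distrib, hr]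
  have h1 : z ^ (n X - 1) ≠ 0 := pow_ne_zero _ hz0
  have h2 : z ^ (∑ Y ∈ L.erase X, n Y) ≠ 0 := pow_ne_zero _ hz0
  have h3 : ∏ Y ∈ L.erase X, (z ^ n Y - s Y) ≠ 0 := Finset.prod_ne_zero_iff.2 fun Y hY =>
    sub_ne_zero.2 (hdisj X hX Y (Finset.mem_of_mem_erase hY) (Finset.ne_of_mem_erase hY).symm z hr)
  have h4 : ∏ Y ∈ L.erase X, (1 - s Y * z ^ n Y) ≠ 0 := Finset.prod_ne_zero_iff.2 fun Y hY =>
    hnz hnorm (Finset.mem_of_mem_erase hY)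
  have h5 : (n X : ℂ) ≠ 0 := Nat.cast_ne_zero.2 (hn X hX).ne'
  have h6 : 1 - s X ^ 2 ≠ 0 := by
    have := hnz hnorm hX
    rwa [hr, ← sq] at this
  rw [← sq]
  generalize z ^ (n X - 1) = A at *
  generalize z ^ (∑ Y ∈ L.erase X, n Y) = B at *
  generalize ∏ Y ∈ L.erase X, (z ^ n Y - s Y) = P at *
  generalize ∏ Y ∈ L.erase X, (1 - s Y * z ^ n Y) = Q at *
  field_simp

/-! ### From the weight count to the residue sum. -/

theorem prod_univ_eq (f : Fin r → ℤ → ℂ) : ∏ x : Theta d, f x.1 (a d x) =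
    (∏ k ∈ Finset.univ.filter (fun k : Fin r => Even (d k)), f k 0) *
      ∏ x ∈ Lam d, f x.1 (-a d x) * f x.1 (a d x) := by
  -- The reflection `i ↦ d_k - i` negates the weight; below, weight 0 occurs exactly once for each
  -- even `d_k`.
  have hneg : ∏ x ∈ Lam d, f x.1 (-a d x) =
      ∏ x ∈ Finset.univ.filter (fun x : Theta d => a d x < 0), f x.1 (a d x) := by
    have ha (x : Theta d) : a d ⟨x.1, Fin.rev x.2⟩ = -a d x := by
      have := x.2.2
      simp only [a, Fin.val_rev]
      omega
    refine Finset.prod_bij' (fun x _ => ⟨x.1, Fin.rev x.2⟩) (fun x _ => ⟨x.1, Fin.rev x.2⟩)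
      (fun x hx => ?_) (fun x hx => ?_) (fun x _ => ?_) (fun x _ => ?_) (fun x _ => ?_)
    · rw [Finset.mem_filter, ha]
      exact ⟨Finset.mem_univ _, by linarith [a_pos hx]⟩
    · rw [Lam, Finset.mem_filter, ha]
      exact ⟨Finset.mem_univ _, by linarith [(Finset.mem_filter.1 hx).2]⟩
    · simp
    · simp
    · rw [ha]
  have hzero : ∏ k ∈ Finset.univ.filter (fun k : Fin r => Even (d k)), f k 0 =
      ∏ x ∈ Finset.univ.filter (fun x : Theta d => a d x = 0), f x.1 (a d x) := by
    symm
    refine Finset.prod_bij (fun x _ => x.1) (fun x hx => ?_) (fun x hx y hy h => ?_)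
      (fun k hk => ?_) (fun x hx => ?_)
    · have := (Finset.mem_filter.1 hx).2
      rw [a] at this
      exact Finset.mem_filter.2 ⟨Finset.mem_univ _, ⟨x.2, by omega⟩⟩
    · have h1 := (Finset.mem_filter.1 hx).2
      have h2 := (Finset.mem_filter.1 hy).2
      obtain ⟨k, i⟩ := x
      obtain ⟨k', j⟩ := y
      obtain rfl : k = k' := h
      simp only [a] at h1 h2
      congr 1
      exact Fin.ext (by omega)
    · obtain ⟨c, hc⟩ := (Finset.mem_filter.1 hk).2
      refine ⟨⟨k, ⟨c, by omega⟩⟩, Finset.mem_filter.2 ⟨Finset.mem_univ _, ?_⟩, rfl⟩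
      simp only [a, hc]
      push_cast
      ring
    · rw [(Finset.mem_filter.1 hx).2]
  rw [Finset.prod_mul_distrib, hneg, hzero,
    ← Finset.prod_filter_mul_prod_filter_not Finset.univ (fun x : Theta d => a d x = 0)]
  congr 1
  rw [← Finset.prod_filter_mul_prod_filter_not _ (fun x : Theta d => a d x < 0),
    Finset.filter_filter, Finset.filter_filter, Lam]
  congr 1 <;> congr 1 <;> ext x <;>
    simp only [Finset.mem_filter, Finset.mem_univ, true_and] <;> omega

theorem prod_pow_multidegree (t : Fin r → ℂ) (m : Theta d →₀ ℕ) :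
    ∏ x, t x.1 ^ m x =
      (Finsupp.weight (fun x : Theta d => Finsupp.single x.1 1) m).prod fun k n => t k ^ n := by
  rw [Finsupp.weight_apply, Finsupp.sum_fintype _ _ (by simp),
    ← Finsupp.prod_finsetSum_index (by simp) (by simp [pow_add])]
  refine Finset.prod_congr rfl fun x _ => ?_
  rw [Finsupp.smul_single, Finsupp.prod_single_index (h := fun k n => t k ^ n) (pow_zero _),
    smul_eq_mul, mul_one]

theorem weight_neg_a (m : Theta d →₀ ℕ) :
    Finsupp.weight (fun x => -a d x) m = -Finsupp.weight (a d) m := by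
  simp [Finsupp.weight_apply, Finsupp.sum]

/-- In one multidegree only finitely many monomials occur. Weight 2 for `-a` in `biweight` is weight
-2 for `a` here. -/
theorem hasSum_fiber (t : Fin r → ℂ) (p : Fin r →₀ ℕ) :
    HasSum (fun m : {m : Theta d →₀ ℕ //
        Finsupp.weight (fun x : Theta d => Finsupp.single x.1 1) m = p} =>
      (∏ x, t x.1 ^ (m : Theta d →₀ ℕ) x) *
        ((if Finsupp.weight (a d) (m : Theta d →₀ ℕ) = 0 then 1 else 0) -
          if Finsupp.weight (a d) (m : Theta d →₀ ℕ) = -2 then 1 else 0))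
      (MvPowerSeries.coeff p (hilbertSeries d) * p.prod fun k n => t k ^ n) := by
  classical
  let S := (finite_multidegree (d := d) p).toFinset
  have hcard (n : ℤ) : {m : Theta d →₀ ℕ | Finsupp.weight (biweight d) m = (p, n)}.ncard =
      (S.filter fun m => Finsupp.weight (a d) m = -n).card := by
    rw [← Set.ncard_coe_finset]
    congr 1
    ext m
    simp [S, weight_biweight, weight_neg_a, neg_eq_iff_eq_neg]
  have hcoeff : MvPowerSeries.coeff p (hilbertSeries d) =
      ((S.filter fun m => Finsupp.weight (a d) m = 0).card : ℂ) -
        (S.filter fun m => Finsupp.weight (a d) m = -2).card := by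
    have h := finrank_gradedPiece (d := d) p
    rw [hcard, hcard, neg_zero] at h
    rw [← h, Nat.cast_add, add_sub_cancel_left]
    rfl
  have h := Finset.hasSum S fun m => (∏ x, t x.1 ^ m x) *
    ((if Finsupp.weight (a d) m = 0 then 1 else 0) -
      if Finsupp.weight (a d) m = -2 then 1 else 0)
  have hsum : ∑ m ∈ S, (∏ x, t x.1 ^ m x) *
    ((if Finsupp.weight (a d) m = 0 then 1 else 0) -
      if Finsupp.weight (a d) m = -2 then 1 else 0) =
      MvPowerSeries.coeff p (hilbertSeries d) * p.prod fun k n => t k ^ n := by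
    rw [hcoeff, mul_comm, ← Finset.sum_boole, ← Finset.sum_boole, ← Finset.sum_sub_distrib,
      Finset.mul_sum]
    refine Finset.sum_congr rfl fun m hm => ?_
    rw [prod_pow_multidegree, (Set.Finite.mem_toFinset _).1 hm]
  rw [hsum] at h
  exact (Equiv.subtypeEquivRight fun m => (Set.Finite.mem_toFinset
    (finite_multidegree (d := d) p)).symm).hasSum_iff.2 h

theorem hasSum_hilbertSeries_constant_term {t : Fin r → ℂ} (ht : ∀ k, ‖t k‖ < 1) :
    HasSum (fun p : Fin r →₀ ℕ =>
        MvPowerSeries.coeff p (hilbertSeries d) * p.prod fun k n => t k ^ n)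
      ((2 * Real.pi * Complex.I)⁻¹ * ∮ z in C(0, 1), (z⁻¹ - z) *
        ∏ x : Theta d, (1 - t x.1 * z ^ a d x)⁻¹) := by
  have h := hasSum_constant_term (t := fun x : Theta d => t x.1) (fun x => ht _) (a d)
  rw [← (Equiv.sigmaFiberEquiv fun m : Theta d →₀ ℕ =>
    Finsupp.weight (fun x : Theta d => Finsupp.single x.1 1) m).hasSum_iff] at h
  exact h.sigma fun p => hasSum_fiber t p

theorem Lam_nonempty (hr : 0 < r) (hd : ∀ k, d k ≠ 0) : (Lam d).Nonempty := by
  refine ⟨⟨⟨0, hr⟩, Fin.last _⟩, Finset.mem_filter.2 ⟨Finset.mem_univ _, ?_⟩⟩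
  have := hd ⟨0, hr⟩
  simp only [a, Fin.val_last]
  omega

/-- A summand `V_0` is trivial, so its constant form 1 would be a nonzero invariant. -/
theorem degree_ne_zero (hV : (rep d).invariants = ⊥) (k : Fin r) : d k ≠ 0 := by
  classical
  intro hk
  have h1 : (1 : MvPolynomial (Fin 2) ℂ) ∈ MvPolynomial.homogeneousSubmodule (Fin 2) ℂ (d k) := by
    rw [hk, MvPolynomial.mem_homogeneousSubmodule]
    exact MvPolynomial.isHomogeneous_one _ _
  let v : V d := Pi.single k ⟨1, h1⟩
  have hv : v ∈ (rep d).invariants := by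
    rw [Representation.mem_invariants]
    intro g
    funext j
    change binaryRep (d j) g (v j) = v j
    by_cases hj : j = k
    · subst hj
      refine Subtype.ext ?_
      change subst g (v j : MvPolynomial (Fin 2) ℂ) = _
      simp [v]
    · simp [v, hj]
  rw [hV, Submodule.mem_bot] at hv
  have := congrArg (fun w : V d => (w k : MvPolynomial (Fin 2) ℂ)) hv
  simp [v] at this

theorem constant_term_eq_residueSum (hL : (Lam d).Nonempty) {t : Fin r → ℂ}
    (ht : t ∈ genericSet d) {l : Fin r → ℂ} (hl : ∀ k, Complex.exp (l k) = t k) :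
    (2 * Real.pi * Complex.I)⁻¹ * (∮ z in C(0, 1), (z⁻¹ - z) *
        ∏ x : Theta d, (1 - t x.1 * z ^ a d x)⁻¹) = residueSum d t l := by
  obtain ⟨ht, hgen⟩ := ht
  have hz {x : Theta d} (hx : x ∈ Lam d) (z : ℂ) : z ^ (a d x) = z ^ (a d x).toNat := by
    rw [← zpow_natCast, Int.toNat_of_nonneg (a_pos hx).le]
  have hcast {x : Theta d} (hx : x ∈ Lam d) : (((a d x).toNat : ℕ) : ℂ) = (a d x : ℂ) := by
    rw [← Int.cast_natCast, Int.toNat_of_nonneg (a_pos hx).le]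
  have hne {x : Theta d} (hx : x ∈ Lam d) : (a d x : ℂ) ≠ 0 :=
    Int.cast_ne_zero.2 (a_pos hx).ne'
  -- The logarithm selects one root `exp (l / a)` of `z ^ a = t`; multiplying by the roots of unity
  -- `ζ` yields all of them.
  have key := circleIntegral_eq_residue_sum hL (n := fun x => (a d x).toNat)
    (s := fun x => t x.1) (w := fun x => Complex.exp (l x.1 / a d x))
    (fun x hx => by have := a_pos hx; omega)
    (fun x hx => by
      rw [← Complex.exp_nat_mul, hcast hx, mul_div_cancel₀ _ (hne hx), hl])
    (fun x _ => (ht _).1) (fun x _ => (ht _).2)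
    (fun x hx y hy hxy z h => by
      rw [← hz hy]
      exact hgen x hx y hy hxy z (by rw [hz hx, h]))
  have hint (z : ℂ) : (z⁻¹ - z) * ∏ x : Theta d, (1 - t x.1 * z ^ a d x)⁻¹ =
      (∏ k ∈ Finset.univ.filter (fun k : Fin r => Even (d k)), (1 - t k))⁻¹ * ((z⁻¹ - z) *
        ∏ x ∈ Lam d, ((1 - t x.1 * (z ^ (a d x).toNat)⁻¹) *
          (1 - t x.1 * z ^ (a d x).toNat))⁻¹) := by
    rw [prod_univ_eq fun k n => (1 - t k * z ^ n)⁻¹, mul_left_comm, ← Finset.prod_inv_distrib]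
    simp only [zpow_zero, mul_one]
    congr 2
    refine Finset.prod_congr rfl fun x hx => ?_
    rw [zpow_neg, hz hx, mul_inv]
  simp only [hint]
  rw [circleIntegral.integral_const_mul, mul_left_comm, key, residueSum, Finset.mul_sum]
  refine Finset.sum_congr rfl fun X hX => ?_
  rw [Finset.mul_sum]
  refine Finset.sum_congr rfl fun ζ _ => ?_
  have hnum : (ζ * Complex.exp (l X.1 / a d X)) ^ 2 =
      ζ ^ 2 * Complex.exp (2 / (a d X : ℂ) * l X.1) := by
    rw [mul_pow, ← Complex.exp_nat_mul]
    congr 2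
    push_cast
    ring
  have hbeta {x : Theta d} (hx : x ∈ Lam d) :
      (1 - t x.1 * ((ζ * Complex.exp (l X.1 / a d X)) ^ (a d x).toNat)⁻¹) *
        (1 - t x.1 * (ζ * Complex.exp (l X.1 / a d X)) ^ (a d x).toNat) = beta d t l X x ζ := by
    have h1 : Complex.exp (l X.1 / a d X) ^ (a d x).toNat =
        Complex.exp ((a d x : ℂ) / (a d X : ℂ) * l X.1) := by
      rw [← Complex.exp_nat_mul, hcast hx]
      congr 1
      ring
    rw [beta, mul_pow, h1, zpow_neg, hz hx, neg_div, neg_mul, Complex.exp_neg, mul_inv]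
    ring
  rw [hnum, hcast hX, Finset.prod_congr rfl fun x hx => hbeta (Finset.mem_of_mem_erase hx),
    ← div_eq_inv_mul, div_div]
  congr 1
  ring

end SL2Hilb
end

theorem proposition3p1 {r : ℕ} (hr : 0 < r) (d : Fin r → ℕ)
    (hV : (SL2Hilb.rep d).invariants = ⊥) :
    (IsOpen (SL2Hilb.genericSet d) ∧
      {t : Fin r → ℂ | ∀ k, ‖t k‖ < 1} ⊆ closure (SL2Hilb.genericSet d)) ∧
    ∀ t ∈ SL2Hilb.genericSet d, ∀ l : Fin r → ℂ, (∀ k, Complex.exp (l k) = t k) →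
      HasSum
        (fun p : Fin r →₀ ℕ =>
          MvPowerSeries.coeff p (SL2Hilb.hilbertSeries d) * p.prod fun k n => t k ^ n)
        (SL2Hilb.residueSum d t l) := by
  refine ⟨⟨SL2Hilb.isOpen_genericSet d, SL2Hilb.subset_closure_genericSet d⟩,
    fun t ht l hl => ?_⟩
  rw [← SL2Hilb.constant_term_eq_residueSum
    (SL2Hilb.Lam_nonempty hr (SL2Hilb.degree_ne_zero hV)) ht hl]
  exact SL2Hilb.hasSum_hilbertSeries_constant_term fun k => (ht.1 k).2
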